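/- Let $m>0$. On $\mathbb{R}^4\cong\mathbb{C}^2$, with coordinates $z_1=x_1+ix_2$, $z_2=x_3+ix_4$, standard complex structure $I_1$ and euclidean norm $r=(|z_1|^2+|z_2|^2)^{1/2}$, let $u,v\colon\mathbb{C}^2\to\mathbb{R}$ be the functions defined implicitly by $$|z_1|=e^{m(u^2-v^2)}u,\qquad |z_2|=e^{m(v^2-u^2)}v,$$ and set $y_1=\frac12(u^2-v^2)$, $y_2+iy_3=-iz_1z_2$, $R=\frac12(u^2+v^2)$ and, away from the origin, $V=\frac{1+4mR}{2R}$ and $\eta=I_1(V\,dy_1)$, where $I_1$ acts on $1$-forms by $I_1\beta=-\beta(I_1\,\cdot)$. Let $\mathbf{f}$ be the Taub-NUT metric $$\mathbf{f}=V(dy_1^2+dy_2^2+dy_3^2)+V^{-1}\eta^2$$ on $\mathbb{R}^4\setminus\{0\}$, extended to $\mathbb{R}^4$ by the euclidean metric at $0$. Let $a\in\mathbb{R}$ and $\kappa>0$, let $\beth\colon\mathbb{R}^4\to\mathbb{R}^4$ be the map $\beth(z_1,z_2)=\bigl(1+\frac{a}{\kappa+r^4}\bigr)(z_1,z_2)$,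 and put $\mathbf{f}^\flat=\beth^*\mathbf{f}$. Then for $\ell=0,1,2$, $$\bigl|(\nabla^{\mathbf{f}})^\ell(\mathbf{f}^\flat-\mathbf{f})\bigr|_{\mathbf{f}}=O(R^{-1})\quad\text{on }\mathbb{R}^4,$$ where $\nabla^{\mathbf{f}}$ is the Levi-Civita connection of $\mathbf{f}$ and $|\cdot|_{\mathbf{f}}$ the pointwise norm that $\mathbf{f}$ induces on tensors. Moreover $\beth^*R=R+O(R^{-1})$. Here $O(R^{-1})$ means bounded in absolute value on $\mathbb{R}^4\setminus\{0\}$ by $C R^{-1}$, with a constant $C$ depending only on $m$, $a$ and $\kappa$. -/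

import Mathlib

noncomputable section

namespace TaubNUT

/-! ### Tensor calculus on `ℝ⁴` in the standard coordinates -/

/-- The space `ℝ⁴`, with its euclidean norm `r = ‖x‖`. -/
abbrev E4 : Type := EuclideanSpace ℝ (Fin 4)

/-- The `i`-th vector of the standard basis. -/
def basisVec (i : Fin 4) : E4 := EuclideanSpace.single i 1

/-- The partial derivative `∂ᵢ F` of a real function. -/
def pderiv (i : Fin 4) (F : E4 → ℝ) (x : E4) : ℝ := fderiv ℝ F x (basisVec i)

/-- A field of bilinear forms, given by its matrix of components `g x i j = g(∂ᵢ, ∂ⱼ)` at `x`. -/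
abbrev BilinField : Type := E4 → Matrix (Fin 4) (Fin 4) ℝ

/-- A covariant tensor field of rank `k`, given by its components
`T x I = T(∂_{I 0}, …, ∂_{I (k-1)})` at `x`. -/
abbrev TensorField (k : ℕ) : Type := E4 → (Fin k → Fin 4) → ℝ

/-- A field of bilinear forms as a covariant tensor field of rank two. -/
def BilinField.toTensor (h : BilinField) : TensorField 2 := fun x I => h x (I 0) (I 1)

/-- The pull-back `F^* g`, whose components are `g(F x)(dF ∂ᵢ, dF ∂ⱼ)`. -/
def pullback (F : E4 → E4) (g : BilinField) : BilinField := fun x =>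
  Matrix.of fun i j => ∑ k : Fin 4, ∑ l : Fin 4,
    g (F x) k l * (fderiv ℝ F x (basisVec i)) k * (fderiv ℝ F x (basisVec j)) l

/-- The Christoffel symbol `Γᵏᵢⱼ = ½ gᵏˡ (∂ᵢ gⱼₗ + ∂ⱼ gᵢₗ - ∂ₗ gᵢⱼ)` of the Levi-Civita
connection of `g`. -/
def christoffel (g : BilinField) (x : E4) (k i j : Fin 4) : ℝ :=
  (1 / 2) * ∑ l : Fin 4, (g x)⁻¹ k l *
    (pderiv i (fun y => g y j l) x + pderiv j (fun y => g y i l) x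
      - pderiv l (fun y => g y i j) x)

/-- The covariant derivative of a covariant tensor field for the Levi-Civita connection of `g`;
the new index (the direction of differentiation) comes first:
`(∇T)_{i j₁…jₖ} = ∂ᵢ T_{j₁…jₖ} - ∑ₛ Γˡ_{i jₛ} T_{j₁…l…jₖ}`. -/
def covDeriv (g : BilinField) {k : ℕ} (T : TensorField k) : TensorField (k + 1) := fun x I =>
  pderiv (I 0) (fun y => T y (Fin.tail I)) x
    - ∑ s : Fin k, ∑ l : Fin 4,
        christoffel g x l (I 0) (Fin.tail I s) * T x (Function.update (Fin.tail I) s l)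

/-- The iterated covariant derivative `∇^ℓ T`. -/
def iterCovDeriv (g : BilinField) {k : ℕ} (T : TensorField k) : (ℓ : ℕ) → TensorField (k + ℓ)
  | 0 => T
  | ℓ + 1 => covDeriv g (iterCovDeriv g T ℓ)

/-- The pointwise norm `|T|_g` of a covariant tensor field, with
`|T|_g² = g^{i₁j₁} ⋯ g^{iₖjₖ} T_{i₁…iₖ} T_{j₁…jₖ}`. -/
def tensorNorm (g : BilinField) {k : ℕ} (T : TensorField k) (x : E4) : ℝ :=
  Real.sqrt (∑ I : Fin k → Fin 4, ∑ J : Fin k → Fin 4,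
    (∏ s : Fin k, (g x)⁻¹ (I s) (J s)) * T x I * T x J)

/-! ### The Taub-NUT metric -/

/-- The complex coordinate `z₁ = x₁ + i x₂`. -/
def z₁ (x : E4) : ℂ := ⟨x 0, x 1⟩

/-- The complex coordinate `z₂ = x₃ + i x₄`. -/
def z₂ (x : E4) : ℂ := ⟨x 2, x 3⟩

/-- The standard complex structure `I₁`, that is, multiplication by `i` in `(z₁, z₂)`. -/
def I₁ (x : E4) : E4 := !₂[-x 1, x 0, -x 3, x 2]

/-- The implicit equations `|z₁| = e^{m(u²-v²)} u`, `|z₂| = e^{m(v²-u²)} v` for the pair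
`p = (u, v)` at the point `x`. -/
def IsLeBrunPair (m : ℝ) (x : E4) (p : ℝ × ℝ) : Prop :=
  ‖z₁ x‖ = Real.exp (m * (p.1 ^ 2 - p.2 ^ 2)) * p.1 ∧
  ‖z₂ x‖ = Real.exp (m * (p.2 ^ 2 - p.1 ^ 2)) * p.2

/-- The implicit equations have exactly one solution at every point. -/
theorem existsUnique_isLeBrunPair {m : ℝ} (hm : 0 < m) (x : E4) :
    ∃! p : ℝ × ℝ, IsLeBrunPair m x p := by
  have mono : StrictMono (fun t : ℝ => t - ‖z₁ x‖ ^ 2 * Real.exp (-(2 * m * t))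
      + ‖z₂ x‖ ^ 2 * Real.exp (2 * m * t)) := by
    intro s t hst
    have h1 : Real.exp (-(2 * m * t)) ≤ Real.exp (-(2 * m * s)) :=
      Real.exp_le_exp.2 (by nlinarith)
    have h2 : Real.exp (2 * m * s) ≤ Real.exp (2 * m * t) := Real.exp_le_exp.2 (by nlinarith)
    have h3 := mul_le_mul_of_nonneg_left h1 (sq_nonneg ‖z₁ x‖)
    have h4 := mul_le_mul_of_nonneg_left h2 (sq_nonneg ‖z₂ x‖)
    show s - _ + _ < t - _ + _
    linarith
  -- every solution is recovered from the root `t = u² - v²`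
  have key : ∀ p : ℝ × ℝ, IsLeBrunPair m x p →
      p.1 = ‖z₁ x‖ * Real.exp (-(m * (p.1 ^ 2 - p.2 ^ 2))) ∧
      p.2 = ‖z₂ x‖ * Real.exp (m * (p.1 ^ 2 - p.2 ^ 2)) := by
    rintro ⟨u, v⟩ ⟨h1, h2⟩
    dsimp only at h1 h2 ⊢
    constructor
    · rw [h1, mul_right_comm, ← Real.exp_add, add_neg_cancel, Real.exp_zero, one_mul]
    · rw [h2, mul_right_comm, ← Real.exp_add,
        show m * (v ^ 2 - u ^ 2) + m * (u ^ 2 - v ^ 2) = 0 by ring, Real.exp_zero, one_mul]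
  have sq1 : ∀ t : ℝ, (‖z₁ x‖ * Real.exp (-(m * t))) ^ 2
      = ‖z₁ x‖ ^ 2 * Real.exp (-(2 * m * t)) := by
    intro t
    rw [mul_pow, ← Real.exp_nat_mul]
    congr 2
    push_cast
    ring
  have sq2 : ∀ t : ℝ, (‖z₂ x‖ * Real.exp (m * t)) ^ 2
      = ‖z₂ x‖ ^ 2 * Real.exp (2 * m * t) := by
    intro t
    rw [mul_pow, ← Real.exp_nat_mul]
    congr 2
    push_cast
    ring
  obtain ⟨t, ht⟩ : ∃ t : ℝ, t - ‖z₁ x‖ ^ 2 * Real.exp (-(2 * m * t))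
      + ‖z₂ x‖ ^ 2 * Real.exp (2 * m * t) = 0 := by
    refine mem_range_of_exists_le_of_exists_ge
      (f := fun t : ℝ => t - ‖z₁ x‖ ^ 2 * Real.exp (-(2 * m * t))
        + ‖z₂ x‖ ^ 2 * Real.exp (2 * m * t)) (by fun_prop)
      ⟨-‖z₂ x‖ ^ 2, ?_⟩ ⟨‖z₁ x‖ ^ 2, ?_⟩
    · have h1 : Real.exp (2 * m * -‖z₂ x‖ ^ 2) ≤ 1 :=
        Real.exp_le_one_iff.2 (by nlinarith [sq_nonneg ‖z₂ x‖])
      have h2 := mul_le_mul_of_nonneg_left h1 (sq_nonneg ‖z₂ x‖)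
      have h3 : 0 ≤ ‖z₁ x‖ ^ 2 * Real.exp (-(2 * m * -‖z₂ x‖ ^ 2)) := by positivity
      linarith
    · have h1 : Real.exp (-(2 * m * ‖z₁ x‖ ^ 2)) ≤ 1 :=
        Real.exp_le_one_iff.2 (by nlinarith [sq_nonneg ‖z₁ x‖])
      have h2 := mul_le_mul_of_nonneg_left h1 (sq_nonneg ‖z₁ x‖)
      have h3 : 0 ≤ ‖z₂ x‖ ^ 2 * Real.exp (2 * m * ‖z₁ x‖ ^ 2) := by positivity
      linarith
  refine ⟨(‖z₁ x‖ * Real.exp (-(m * t)), ‖z₂ x‖ * Real.exp (m * t)), ?_, ?_⟩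
  · have hdiff : (‖z₁ x‖ * Real.exp (-(m * t))) ^ 2 - (‖z₂ x‖ * Real.exp (m * t)) ^ 2 = t := by
      rw [sq1, sq2]
      linarith
    have hdiff2 : (‖z₂ x‖ * Real.exp (m * t)) ^ 2 - (‖z₁ x‖ * Real.exp (-(m * t))) ^ 2 = -t := by
      linarith
    refine ⟨?_, ?_⟩
    · dsimp only
      rw [hdiff, mul_left_comm, ← Real.exp_add, add_neg_cancel, Real.exp_zero, mul_one]
    · dsimp only
      rw [hdiff2, mul_left_comm, ← Real.exp_add, mul_neg, neg_add_cancel, Real.exp_zero, mul_one]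
  · intro p hp
    obtain ⟨k1, k2⟩ := key p hp
    have hroot : (p.1 ^ 2 - p.2 ^ 2) - ‖z₁ x‖ ^ 2 * Real.exp (-(2 * m * (p.1 ^ 2 - p.2 ^ 2)))
        + ‖z₂ x‖ ^ 2 * Real.exp (2 * m * (p.1 ^ 2 - p.2 ^ 2)) = 0 := by
      rw [← sq1, ← sq2, ← k1, ← k2]
      ring
    have heq : p.1 ^ 2 - p.2 ^ 2 = t := mono.injective (hroot.trans ht.symm)
    rw [heq] at k1 k2
    exact Prod.ext k1 k2

/-- The pair of functions `(u, v)` solving the implicit equations. -/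
def uv (m : ℝ) (x : E4) : ℝ × ℝ := Classical.epsilon (IsLeBrunPair m x)

theorem isLeBrunPair_uv {m : ℝ} (hm : 0 < m) (x : E4) : IsLeBrunPair m x (uv m x) :=
  Classical.epsilon_spec (existsUnique_isLeBrunPair hm x).exists

/-- The functions `y₁ = ½(u² - v²)` and `y₂ + i y₃ = -i z₁ z₂`. -/
def y (m : ℝ) : Fin 3 → E4 → ℝ :=
  ![fun x => (1 / 2) * ((uv m x).1 ^ 2 - (uv m x).2 ^ 2),
    fun x => (-Complex.I * z₁ x * z₂ x).re,
    fun x => (-Complex.I * z₁ x * z₂ x).im]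

/-- The function `R = ½(u² + v²)`. -/
def R (m : ℝ) (x : E4) : ℝ := (1 / 2) * ((uv m x).1 ^ 2 + (uv m x).2 ^ 2)

/-- The function `V = (1 + 4mR) / (2R)`, on `ℝ⁴ ∖ {0}`. -/
def V (m : ℝ) (x : E4) : ℝ := (1 + 4 * m * R m x) / (2 * R m x)

/-- The connection form `η = I₁ (V dy₁)`, on `ℝ⁴ ∖ {0}`, evaluated on the vector `X` at `x`;
here `I₁` acts on a one-form `β` by `I₁ β = -β(I₁ ·)`. -/
def η (m : ℝ) (x X : E4) : ℝ := -(V m x * fderiv ℝ (y m 0) x (I₁ X))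

/-- The Taub-NUT metric `f = V (dy₁² + dy₂² + dy₃²) + V⁻¹ η²` on `ℝ⁴ ∖ {0}`, extended by the
euclidean metric at the origin. -/
def taubNUT (m : ℝ) : BilinField := fun x =>
  open Classical in
  if x = 0 then 1
  else Matrix.of fun i j =>
    V m x * (∑ a : Fin 3, pderiv i (y m a) x * pderiv j (y m a) x)
      + (V m x)⁻¹ * (η m x (basisVec i) * η m x (basisVec j))

/-- The map `ℶ(z₁, z₂) = (1 + a / (κ + r⁴)) (z₁, z₂)`. -/
def beth (a κ : ℝ) (x : E4) : E4 := (1 + a / (κ + ‖x‖ ^ 4)) • x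

end TaubNUT

end

/-!
In the coframe `dy₁, dy₂, dy₃, η` the metric is diagonal, with entries `V, V, V, V⁻¹`. Away from the
origin the functions that are bounded together with all their coframe derivatives form an algebra
containing `R⁻¹`, `yᵢ / R` and `V`; since `dη` has coefficients `O(R⁻²)` in the coframe, Koszul's
formula puts the connection coefficients into this algebra. Covariant differentiation therefore
does not worsen the order of decay of a tensor whose components decay with all their coframe
derivatives. The dilation `ℶ` has a factor `λ` with `λ² - 1 = O(r⁻⁴) = O(R⁻²)`, so that it moves the
functions `yᵢ`, of order `R`, only by `O(R⁻¹)`, again with all coframe derivatives, and the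
components of `ℶ^* f - f` are of order `R⁻¹`. On a neighbourhood of the origin compactness suffices,
because `f` is smooth across the origin.
-/

noncomputable section

namespace TaubNUT

open Asymptotics Filter Matrix
open scoped ContDiff Topology

/-! ### Functions bounded together with their derivatives along a coframe -/

section Symbol

variable {E ι : Type*} [NormedAddCommGroup E] [NormedSpace ℝ E] [Fintype ι]

/-- The function `F` and its derivatives of order at most `n` along the family of one-forms `θ`
are `O(w)` on `Ω`: these are the symbols of weight `w`, as in the theory of pseudodifferential
operators. The derivative along `θₐ` is the coefficient of `θₐ` in an expansion of `dF`; when the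
`θₐ` do not form a coframe it need not be unique. -/
def IsSymbol (θ : ι → E → E →L[ℝ] ℝ) (Ω : Set E) (w : E → ℝ) : ℕ → (E → ℝ) → Prop
  | 0, F => F =O[𝓟 Ω] w
  | n + 1, F => F =O[𝓟 Ω] w ∧ ∃ F' : ι → E → ℝ,
      (∀ x ∈ Ω, HasFDerivAt F (∑ a, F' a x • θ a x) x) ∧ ∀ a, IsSymbol θ Ω w n (F' a)

namespace IsSymbol

variable {θ : ι → E → E →L[ℝ] ℝ} {Ω : Set E} {w w' : E → ℝ} {n : ℕ} {F G : E → ℝ}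

theorem isBigO (h : IsSymbol θ Ω w n F) : F =O[𝓟 Ω] w := by
  cases n with
  | zero => exact h
  | succ n => exact h.1

theorem of_succ (h : IsSymbol θ Ω w (n + 1) F) : IsSymbol θ Ω w n F := by
  induction n generalizing F with
  | zero => exact h.1
  | succ n ih =>
    obtain ⟨hF, F', hd, hF'⟩ := h
    exact ⟨hF, F', hd, fun a => ih (hF' a)⟩

theorem weight_mono (hw : w =O[𝓟 Ω] w') (h : IsSymbol θ Ω w n F) : IsSymbol θ Ω w' n F := by
  induction n generalizing F with
  | zero => exact h.isBigO.trans hw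
  | succ n ih =>
    obtain ⟨hF, F', hd, hF'⟩ := h
    exact ⟨hF.trans hw, F', hd, fun a => ih (hF' a)⟩

theorem congr (hΩ : IsOpen Ω) (h : IsSymbol θ Ω w n F) (hFG : Set.EqOn F G Ω) :
    IsSymbol θ Ω w n G := by
  have hG : G =O[𝓟 Ω] w :=
    h.isBigO.congr' (eventually_principal.2 fun x hx => hFG hx) EventuallyEq.rfl
  cases n with
  | zero => exact hG
  | succ n =>
    obtain ⟨-, F', hd, hF'⟩ := h
    exact ⟨hG, F', fun x hx => (hd x hx).congr_of_eventuallyEq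
      (hFG.symm.eventuallyEq_of_mem (hΩ.mem_nhds hx)), hF'⟩

theorem zero : IsSymbol θ Ω w n fun _ => 0 := by
  induction n with
  | zero => exact isBigO_zero _ _
  | succ n ih => exact ⟨isBigO_zero _ _, fun _ _ => 0,
      fun x _ => (hasFDerivAt_const _ _).congr_fderiv (by simp), fun _ => ih⟩

theorem const (c : ℝ) : IsSymbol θ Ω 1 n fun _ => c := by
  cases n with
  | zero => exact isBigO_const_one ℝ c _
  | succ n => exact ⟨isBigO_const_one ℝ c _, fun _ _ => 0,
      fun x _ => (hasFDerivAt_const _ _).congr_fderiv (by simp), fun _ => zero⟩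

theorem add (hF : IsSymbol θ Ω w n F) (hG : IsSymbol θ Ω w n G) :
    IsSymbol θ Ω w n fun x => F x + G x := by
  induction n generalizing F G with
  | zero => exact hF.isBigO.add hG.isBigO
  | succ n ih =>
    obtain ⟨hF0, F', hFd, hF'⟩ := hF
    obtain ⟨hG0, G', hGd, hG'⟩ := hG
    refine ⟨hF0.add hG0, fun a x => F' a x + G' a x, fun x hx => ?_,
      fun a => ih (hF' a) (hG' a)⟩
    refine ((hFd x hx).add (hGd x hx)).congr_fderiv ?_
    simp only [add_smul, Finset.sum_add_distrib]

theorem mul (hF : IsSymbol θ Ω w n F) (hG : IsSymbol θ Ω w' n G) :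
    IsSymbol θ Ω (w * w') n fun x => F x * G x := by
  induction n generalizing F G with
  | zero => exact hF.isBigO.mul hG.isBigO
  | succ n ih =>
    have hFn := hF.of_succ
    have hGn := hG.of_succ
    obtain ⟨hF0, F', hFd, hF'⟩ := hF
    obtain ⟨hG0, G', hGd, hG'⟩ := hG
    refine ⟨hF0.mul hG0, fun a x => F x * G' a x + F' a x * G x, fun x hx => ?_,
      fun a => (ih hFn (hG' a)).add (ih (hF' a) hGn)⟩
    refine ((hFd x hx).mul (hGd x hx)).congr_fderiv ?_
    simp only [add_smul, Finset.sum_add_distrib, Finset.smul_sum, smul_smul, mul_comm]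

theorem const_mul (c : ℝ) (hF : IsSymbol θ Ω w n F) : IsSymbol θ Ω w n fun x => c * F x := by
  simpa only [one_mul] using (const c).mul hF

theorem neg (hF : IsSymbol θ Ω w n F) : IsSymbol θ Ω w n fun x => -F x := by
  simpa only [neg_one_mul] using hF.const_mul (-1)

theorem sub (hF : IsSymbol θ Ω w n F) (hG : IsSymbol θ Ω w n G) :
    IsSymbol θ Ω w n fun x => F x - G x := by
  simpa only [sub_eq_add_neg] using hF.add hG.neg

theorem sum {κ : Type*} {F : κ → E → ℝ} (s : Finset κ) (hF : ∀ i ∈ s, IsSymbol θ Ω w n (F i)) :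
    IsSymbol θ Ω w n fun x => ∑ i ∈ s, F i x := by
  classical
  induction s using Finset.induction_on with
  | empty => simpa only [Finset.sum_empty] using zero
  | insert i s hi ih =>
    simp only [Finset.sum_insert hi]
    exact (hF i (Finset.mem_insert_self i s)).add
      (ih fun j hj => hF j (Finset.mem_insert_of_mem hj))

theorem inv (hw : ∀ x ∈ Ω, w x ≠ 0) (hwF : w =O[𝓟 Ω] F) (hF : IsSymbol θ Ω w n F) :
    IsSymbol θ Ω w⁻¹ n fun x => (F x)⁻¹ := by
  have hF_ne : ∀ x ∈ Ω, F x ≠ 0 := fun x hx hFx => hw x hx (by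
    obtain ⟨C, hC⟩ := isBigO_principal.1 hwF
    simpa [hFx] using hC x hx)
  have hinv : (fun x => (F x)⁻¹) =O[𝓟 Ω] w⁻¹ :=
    hwF.inv_rev (eventually_principal.2 fun x hx h => absurd h (hw x hx))
  induction n with
  | zero => exact hinv
  | succ n ih =>
    have hn := ih hF.of_succ
    obtain ⟨-, F', hd, hF'⟩ := hF
    refine ⟨hinv, fun a x => -((F x)⁻¹ * (F x)⁻¹ * F' a x), fun x hx => ?_, fun a => ?_⟩
    · refine ((hasDerivAt_inv (hF_ne x hx)).comp_hasFDerivAt x (hd x hx)).congr_fderiv ?_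
      rw [Finset.smul_sum]
      refine Finset.sum_congr rfl fun a _ => ?_
      rw [smul_smul]
      congr 1
      field_simp
    · refine ((hn.mul hn).mul (hF' a)).neg.weight_mono (IsBigO.of_bound 1 ?_)
      refine eventually_principal.2 fun x hx => le_of_eq ?_
      rw [one_mul]
      congr 1
      simp only [Pi.mul_apply, Pi.inv_apply]
      field_simp [hw x hx]

theorem of_hasFDerivAt_mul {c : ι → E → ℝ} (hF : F =O[𝓟 Ω] w)
    (hd : ∀ x ∈ Ω, HasFDerivAt F (∑ a, (F x * c a x) • θ a x) x)
    (hc : ∀ a, IsSymbol θ Ω 1 n (c a)) : IsSymbol θ Ω w (n + 1) F := by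
  have hmul (k : ℕ) (hFk : IsSymbol θ Ω w k F) (hck : ∀ a, IsSymbol θ Ω 1 k (c a)) (a : ι) :
      IsSymbol θ Ω w k fun x => F x * c a x := by
    simpa only [mul_one] using hFk.mul (hck a)
  induction n with
  | zero => exact ⟨hF, _, hd, hmul 0 hF hc⟩
  | succ n ih => exact ⟨hF, _, hd, hmul (n + 1) (ih fun a => (hc a).of_succ) hc⟩

theorem exp (hF : IsSymbol θ Ω 1 n F) : IsSymbol θ Ω 1 n fun x => Real.exp (F x) := by
  have hexp : (fun x => Real.exp (F x)) =O[𝓟 Ω] (1 : E → ℝ) := by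
    obtain ⟨C, hC⟩ := isBigO_principal.1 hF.isBigO
    refine isBigO_principal.2 ⟨Real.exp C, fun x hx => ?_⟩
    have hFx : F x ≤ C := (le_abs_self _).trans (by simpa using hC x hx)
    simpa using hFx
  cases n with
  | zero => exact hexp
  | succ n =>
    obtain ⟨-, F', hd, hF'⟩ := hF
    refine of_hasFDerivAt_mul hexp (fun x hx => ((hd x hx).exp).congr_fderiv ?_) hF'
    simp only [Finset.smul_sum, smul_smul]

end IsSymbol

end Symbol

/-! ### Smooth matrices -/

section SmoothMatrix

variable {E ι : Type*} [NormedAddCommGroup E] [NormedSpace ℝ E] [Fintype ι] [DecidableEq ι]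
  {n : WithTop ℕ∞} {M : E → Matrix ι ι ℝ}

theorem contDiff_det (hM : ∀ i j, ContDiff ℝ n fun x => M x i j) :
    ContDiff ℝ n fun x => (M x).det := by
  simp only [det_apply]
  exact ContDiff.sum fun σ _ => (contDiff_prod fun i _ => hM _ _).const_smul _

theorem contDiff_matrix_inv (hM : ∀ i j, ContDiff ℝ n fun x => M x i j)
    (hdet : ∀ x, (M x).det ≠ 0) (i j : ι) : ContDiff ℝ n fun x => (M x)⁻¹ i j := by
  simp only [inv_def, Ring.inverse_eq_inv', Matrix.smul_apply, smul_eq_mul, adjugate_apply]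
  refine ((contDiff_det hM).inv hdet).mul (contDiff_det fun k l => ?_)
  by_cases hk : k = j
  · subst hk
    simpa only [updateRow_self] using contDiff_const
  · simpa only [updateRow_ne hk] using hM k l

end SmoothMatrix

/-! ### The Koszul formula -/

section Koszul

variable {ι : Type*} [DecidableEq ι] {d : ι → ℝ} {d' : ι → ι → ℝ} {τ : ι → ι → ι → ℝ}

/-- The Koszul formula for the components `γᶜₐ_b = θᶜ(∇ₐ e_b)` of the Levi-Civita connection of
`∑ₐ dₐ θᵃ ⊗ θᵃ`, where `d(dₐ) = ∑ d'ₐ_b θᵇ` and `dθᶜ` has the components `τᶜₐ_b`. -/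
def connCoeff (d : ι → ℝ) (d' : ι → ι → ℝ) (τ : ι → ι → ι → ℝ) (c a b : ι) : ℝ :=
  (2 * d c)⁻¹ * ((if b = c then d' c a else 0) + (if a = c then d' c b else 0)
    - (if a = b then d' a c else 0) - d c * τ c a b + d b * τ b a c + d a * τ a b c)

theorem connCoeff_sub_swap (hd : ∀ a, d a ≠ 0) (hτ : ∀ c a b, τ c b a = -τ c a b) (c a b : ι) :
    connCoeff d d' τ c a b - connCoeff d d' τ c b a = -τ c a b := by
  have hc := hd c
  have hdiag : (if b = a then d' b c else 0) = if a = b then d' a c else 0 := by grind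
  simp only [connCoeff, hdiag, hτ c a b]
  field_simp
  ring

theorem mul_connCoeff_add_swap (hd : ∀ a, d a ≠ 0) (hτ : ∀ c a b, τ c b a = -τ c a b)
    (a b c : ι) : d c * connCoeff d d' τ c a b + d b * connCoeff d d' τ b a c
      = if b = c then d' c a else 0 := by
  have hc := hd c
  have hb := hd b
  have hbc : (if c = b then d' b a else 0) = if b = c then d' c a else 0 := by grind
  have hab : (if a = b then d' b c else 0) = if a = b then d' a c else 0 := by grind
  have hac : (if a = c then d' c b else 0) = if a = c then d' a b else 0 := by grind
  simp only [connCoeff, hbc, hab, hac, hτ a b c]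
  field_simp
  ring

end Koszul

/-- A torsion-free metric connection is the Levi-Civita connection: here `N i c j` stands for
`θᶜ(∇ᵢ ∂ⱼ)` and `g' i j l` for `∂ᵢ gⱼₗ`. -/
theorem koszul_formula {ι n : Type*} [Fintype ι] {d : ι → ℝ} {Θ : Matrix ι n ℝ}
    {N : n → ι → n → ℝ} {g' : n → n → n → ℝ}
    (hN : ∀ i c j, N i c j = N j c i)
    (hg : ∀ i j l, g' i j l = ∑ c, d c * (N i c j * Θ c l + Θ c j * N i c l)) (i j l : n) :
    g' i j l + g' j i l - g' l i j = 2 * ∑ c, d c * Θ c l * N i c j := by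
  rw [hg, hg, hg, ← Finset.sum_add_distrib, ← Finset.sum_sub_distrib, Finset.mul_sum]
  refine Finset.sum_congr rfl fun c _ => ?_
  rw [hN j c i, hN l c i, hN l c j]
  ring

/-! ### The Levi-Civita connection in a coframe -/

/-- The matrix `θₐ(∂ᵢ)` of a family of one-forms. -/
def coframeMatrix (θ : Fin 4 → E4 → E4 →L[ℝ] ℝ) (x : E4) : Matrix (Fin 4) (Fin 4) ℝ :=
  Matrix.of fun a i => θ a x (basisVec i)

/-- On `Ω` the family `θ` is a coframe in which `g = ∑ₐ dₐ θₐ ⊗ θₐ` is diagonal and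
nondegenerate. -/
structure Diagonalizes (θ : Fin 4 → E4 → E4 →L[ℝ] ℝ) (d : Fin 4 → E4 → ℝ) (g : BilinField)
    (Ω : Set E4) : Prop where
  eq_sum : ∀ x ∈ Ω, ∀ i j,
    g x i j = ∑ a, d a x * (coframeMatrix θ x a i * coframeMatrix θ x a j)
  ne_zero : ∀ x ∈ Ω, ∀ a, d a x ≠ 0
  isUnit_det : ∀ x ∈ Ω, IsUnit (coframeMatrix θ x).det

/-- On `Ω` the one-forms `θ` are differentiable, with `dθ_c = ½ ∑ τ_cab θₐ ∧ θ_b`. -/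
structure HasStructureCoeffs (θ : Fin 4 → E4 → E4 →L[ℝ] ℝ) (τ : Fin 4 → Fin 4 → Fin 4 → E4 → ℝ)
    (Ω : Set E4) : Prop where
  differentiableAt : ∀ x ∈ Ω, ∀ c i, DifferentiableAt ℝ (fun z => coframeMatrix θ z c i) x
  antisymm : ∀ x ∈ Ω, ∀ c a b, τ c b a x = -τ c a b x
  extDeriv : ∀ x ∈ Ω, ∀ c i j,
    pderiv i (fun z => coframeMatrix θ z c j) x - pderiv j (fun z => coframeMatrix θ z c i) x
      = ∑ a, ∑ b, τ c a b x * (coframeMatrix θ x a i * coframeMatrix θ x b j)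

/-- The component `θ_c(∇ᵢ ∂ⱼ)` for the connection `∇` with `θ_c(∇ₐ e_b) = γ_cab`, where `e` is the
frame dual to `θ`. -/
def frameConnection (θ : Fin 4 → E4 → E4 →L[ℝ] ℝ) (γ : Fin 4 → Fin 4 → Fin 4 → E4 → ℝ) (x : E4)
    (i c j : Fin 4) : ℝ :=
  pderiv i (fun z => coframeMatrix θ z c j) x
    + ∑ a, ∑ b, γ c a b x * (coframeMatrix θ x a i * coframeMatrix θ x b j)

/-- On `Ω` the Levi-Civita connection of `g` has the components `θ_c(∇ₐ e_b) = γ_cab`, where `e`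
is the frame dual to `θ`. -/
def HasConnectionCoeffs (g : BilinField) (θ : Fin 4 → E4 → E4 →L[ℝ] ℝ)
    (γ : Fin 4 → Fin 4 → Fin 4 → E4 → ℝ) (Ω : Set E4) : Prop :=
  ∀ x ∈ Ω, ∀ c i j,
    ∑ k, christoffel g x k i j * coframeMatrix θ x c k = frameConnection θ γ x i c j

section Coframe

variable {g : BilinField} {θ : Fin 4 → E4 → E4 →L[ℝ] ℝ} {d : Fin 4 → E4 → ℝ}
  {d' : Fin 4 → Fin 4 → E4 → ℝ} {τ γ : Fin 4 → Fin 4 → Fin 4 → E4 → ℝ} {Ω : Set E4} {x : E4}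

theorem pderiv_eq_sum {F : E4 → ℝ} {F' : Fin 4 → ℝ}
    (hF : HasFDerivAt F (∑ a, F' a • θ a x) x) (i : Fin 4) :
    pderiv i F x = ∑ a, F' a * coframeMatrix θ x a i := by
  simp only [pderiv, hF.fderiv, _root_.sum_apply, _root_.smul_apply, smul_eq_mul, coframeMatrix,
    of_apply]

theorem HasStructureCoeffs.mono {Ω' : Set E4} (h : HasStructureCoeffs θ τ Ω) (hΩ : Ω' ⊆ Ω) :
    HasStructureCoeffs θ τ Ω' where
  differentiableAt x hx := h.differentiableAt x (hΩ hx)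
  antisymm x hx := h.antisymm x (hΩ hx)
  extDeriv x hx := h.extDeriv x (hΩ hx)

namespace Diagonalizes

theorem mono {Ω' : Set E4} (h : Diagonalizes θ d g Ω) (hΩ : Ω' ⊆ Ω) : Diagonalizes θ d g Ω' where
  eq_sum x hx := h.eq_sum x (hΩ hx)
  ne_zero x hx := h.ne_zero x (hΩ hx)
  isUnit_det x hx := h.isUnit_det x (hΩ hx)

theorem eq_transpose_mul_mul (h : Diagonalizes θ d g Ω) (hx : x ∈ Ω) :
    g x = (coframeMatrix θ x)ᵀ * diagonal (fun a => d a x) * coframeMatrix θ x := by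
  ext i j
  rw [h.eq_sum x hx, mul_apply]
  refine Finset.sum_congr rfl fun a _ => ?_
  rw [mul_diagonal, transpose_apply]
  ring

theorem det_ne_zero (h : Diagonalizes θ d g Ω) (hx : x ∈ Ω) : (g x).det ≠ 0 := by
  have hθ := (h.isUnit_det x hx).ne_zero
  rw [h.eq_transpose_mul_mul hx, det_mul, det_mul, det_transpose, det_diagonal]
  exact mul_ne_zero (mul_ne_zero hθ (Finset.prod_ne_zero_iff.2 fun a _ => h.ne_zero x hx a)) hθ

theorem mul_inv_mul_transpose (h : Diagonalizes θ d g Ω) (hx : x ∈ Ω) :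
    coframeMatrix θ x * (g x)⁻¹ * (coframeMatrix θ x)ᵀ = diagonal fun a => (d a x)⁻¹ := by
  have hθ := h.isUnit_det x hx
  have hdd : diagonal (fun a => d a x) * diagonal (fun a => (d a x)⁻¹) = 1 := by
    rw [diagonal_mul_diagonal, ← diagonal_one]
    exact congrArg _ (funext fun a => mul_inv_cancel₀ (h.ne_zero x hx a))
  have hright : coframeMatrix θ x * (g x)⁻¹ * (coframeMatrix θ x)ᵀ * diagonal (fun a => d a x)
      = 1 := by
    calc _ = coframeMatrix θ x * ((g x)⁻¹ * ((coframeMatrix θ x)ᵀ * diagonal (fun a => d a x)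
            * coframeMatrix θ x)) * (coframeMatrix θ x)⁻¹ := by
          simp only [Matrix.mul_assoc, mul_nonsing_inv _ hθ, Matrix.mul_one]
      _ = 1 := by
          rw [← h.eq_transpose_mul_mul hx,
            nonsing_inv_mul _ (isUnit_iff_ne_zero.2 (h.det_ne_zero hx)), Matrix.mul_one,
            mul_nonsing_inv _ hθ]
  calc _ = _ * (diagonal (fun a => d a x) * diagonal fun a => (d a x)⁻¹) := by
        rw [hdd, Matrix.mul_one]
    _ = _ := by rw [← Matrix.mul_assoc, hright, Matrix.one_mul]

theorem sum_inv_mul (h : Diagonalizes θ d g Ω) (hx : x ∈ Ω) (a b : Fin 4) :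
    ∑ i, ∑ j, (g x)⁻¹ i j * (coframeMatrix θ x a i * coframeMatrix θ x b j)
      = if a = b then (d a x)⁻¹ else 0 := by
  have hab := congrFun₂ (h.mul_inv_mul_transpose hx) a b
  rw [diagonal_apply, mul_apply] at hab
  rw [← hab, Finset.sum_comm]
  refine Finset.sum_congr rfl fun j _ => ?_
  rw [mul_apply, Finset.sum_mul, transpose_apply]
  exact Finset.sum_congr rfl fun i _ => by ring

theorem coframeMatrix_mulVec_raise (h : Diagonalizes θ d g Ω) (hx : x ∈ Ω) (s : Fin 4 → ℝ) :
    coframeMatrix θ x *ᵥ ((g x)⁻¹ *ᵥ fun l => ∑ b, d b x * coframeMatrix θ x b l * s b) = s := by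
  have hlower : (fun l => ∑ b, d b x * coframeMatrix θ x b l * s b)
      = (coframeMatrix θ x)ᵀ *ᵥ fun b => d b x * s b := by
    ext l
    simp only [mulVec, dotProduct, transpose_apply]
    exact Finset.sum_congr rfl fun b _ => by ring
  rw [hlower, mulVec_mulVec, mulVec_mulVec, h.mul_inv_mul_transpose hx]
  ext a
  rw [mulVec_diagonal, inv_mul_cancel_left₀ (h.ne_zero x hx a)]

theorem pderiv_eq (h : Diagonalizes θ d g Ω) (hΩ : IsOpen Ω) (hθ : HasStructureCoeffs θ τ Ω)
    (hd : ∀ x ∈ Ω, ∀ a, HasFDerivAt (d a) (∑ b, d' a b x • θ b x) x) (hx : x ∈ Ω)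
    (i j l : Fin 4) :
    pderiv i (fun z => g z j l) x = ∑ c, ((∑ b, d' c b x * coframeMatrix θ x b i)
        * (coframeMatrix θ x c j * coframeMatrix θ x c l)
      + d c x * (pderiv i (fun z => coframeMatrix θ z c j) x * coframeMatrix θ x c l
        + coframeMatrix θ x c j * pderiv i (fun z => coframeMatrix θ z c l) x)) := by
  have hloc : (fun z => g z j l) =ᶠ[𝓝 x]
      fun z => ∑ c, d c z * (coframeMatrix θ z c j * coframeMatrix θ z c l) :=
    eventually_of_mem (hΩ.mem_nhds hx) fun z hz => h.eq_sum z hz j l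
  have hsum : HasFDerivAt
      (fun z => ∑ c, d c z * (coframeMatrix θ z c j * coframeMatrix θ z c l)) _ x :=
    HasFDerivAt.fun_sum fun c (_ : c ∈ Finset.univ) =>
      (hd x hx c).mul ((hθ.differentiableAt x hx c j).hasFDerivAt.mul
        (hθ.differentiableAt x hx c l).hasFDerivAt)
  rw [pderiv, hloc.fderiv_eq, hsum.fderiv]
  simp only [_root_.sum_apply, _root_.add_apply, _root_.smul_apply, smul_eq_mul, pderiv]
  refine Finset.sum_congr rfl fun c _ => ?_
  rw [show (∑ b, d' c b x * coframeMatrix θ x b i)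
    = ∑ b, d' c b x * θ b x (basisVec i) from rfl]
  ring

end Diagonalizes

theorem HasStructureCoeffs.frameConnection_symm (hθ : HasStructureCoeffs θ τ Ω) (hx : x ∈ Ω)
    (hγ : ∀ c a b, γ c a b x - γ c b a x = -τ c a b x) (i c j : Fin 4) :
    frameConnection θ γ x i c j = frameConnection θ γ x j c i := by
  have hswap : ∑ a, ∑ b, γ c a b x * (coframeMatrix θ x a j * coframeMatrix θ x b i)
      = ∑ a, ∑ b, γ c b a x * (coframeMatrix θ x a i * coframeMatrix θ x b j) := by
    rw [Finset.sum_comm]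
    exact Finset.sum_congr rfl fun a _ => Finset.sum_congr rfl fun b _ => by ring
  have htorsion : ∑ a, ∑ b, γ c a b x * (coframeMatrix θ x a i * coframeMatrix θ x b j)
      - ∑ a, ∑ b, γ c b a x * (coframeMatrix θ x a i * coframeMatrix θ x b j)
      = -∑ a, ∑ b, τ c a b x * (coframeMatrix θ x a i * coframeMatrix θ x b j) := by
    simp only [← Finset.sum_sub_distrib, ← sub_mul, hγ, neg_mul, Finset.sum_neg_distrib]
  rw [frameConnection, frameConnection, hswap]
  linear_combination hθ.extDeriv x hx c i j + htorsion

/-- Metric compatibility, in the frame, of the connection with components `γ`. -/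
theorem sum_mul_connection_eq {ι n : Type*} [Fintype ι] [DecidableEq ι] {Θ : Matrix ι n ℝ}
    {d : ι → ℝ} {d' : ι → ι → ℝ} {γ : ι → ι → ι → ℝ}
    (hγ : ∀ a b c, d c * γ c a b + d b * γ b a c = if b = c then d' c a else 0) (i j l : n) :
    ∑ c, d c * ((∑ a, ∑ b, γ c a b * (Θ a i * Θ b j)) * Θ c l
        + Θ c j * ∑ a, ∑ b, γ c a b * (Θ a i * Θ b l))
      = ∑ c, (∑ a, d' c a * Θ a i) * (Θ c j * Θ c l) := by
  have hinner (c : ι) (k : n) : ∑ a, ∑ b, γ c a b * (Θ a i * Θ b k)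
      = ∑ b, (∑ a, γ c a b * Θ a i) * Θ b k := by
    rw [Finset.sum_comm]
    simp only [Finset.sum_mul, mul_assoc]
  have hcompat (b c : ι) : d c * ∑ a, γ c a b * Θ a i + d b * ∑ a, γ b a c * Θ a i
      = if b = c then ∑ a, d' c a * Θ a i else 0 := by
    simp only [Finset.mul_sum, ← mul_assoc, ← Finset.sum_add_distrib, ← add_mul, hγ]
    split_ifs <;> simp
  calc _ = ∑ c, ∑ b, d c * (∑ a, γ c a b * Θ a i) * (Θ b j * Θ c l)
        + ∑ c, ∑ b, d c * (∑ a, γ c a b * Θ a i) * (Θ c j * Θ b l) := by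
        simp only [hinner, mul_add, Finset.sum_add_distrib]
        simp only [Finset.mul_sum, mul_left_comm, mul_comm]
    _ = ∑ c, ∑ b, (d c * (∑ a, γ c a b * Θ a i) + d b * ∑ a, γ b a c * Θ a i)
          * (Θ b j * Θ c l) := by
        rw [Finset.sum_comm (f := fun c b => d c * (∑ a, γ c a b * Θ a i) * (Θ c j * Θ b l))]
        simp only [add_mul, Finset.sum_add_distrib]
    _ = _ := by
        simp only [hcompat, ite_mul, zero_mul, Finset.sum_ite_eq', Finset.mem_univ, if_true]

theorem hasConnectionCoeffs_connCoeff (hΩ : IsOpen Ω) (hg : Diagonalizes θ d g Ω)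
    (hθ : HasStructureCoeffs θ τ Ω)
    (hd : ∀ x ∈ Ω, ∀ a, HasFDerivAt (d a) (∑ b, d' a b x • θ b x) x) :
    HasConnectionCoeffs g θ (fun c a b x => connCoeff (fun c => d c x) (fun c b => d' c b x)
      (fun c a b => τ c a b x) c a b) Ω := by
  intro x hx c i j
  set γ : Fin 4 → Fin 4 → Fin 4 → E4 → ℝ := fun c a b x => connCoeff (fun c => d c x)
    (fun c b => d' c b x) (fun c a b => τ c a b x) c a b
  have htorsion := hθ.frameConnection_symm (γ := γ) hx
    (connCoeff_sub_swap (hg.ne_zero x hx) (hθ.antisymm x hx))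
  have hmetric (i j l : Fin 4) : pderiv i (fun z => g z j l) x
      = ∑ c, d c x * (frameConnection θ γ x i c j * coframeMatrix θ x c l
        + coframeMatrix θ x c j * frameConnection θ γ x i c l) := by
    rw [hg.pderiv_eq hΩ hθ hd hx, Finset.sum_add_distrib, ← sum_mul_connection_eq
      (mul_connCoeff_add_swap (hg.ne_zero x hx) (hθ.antisymm x hx)),
      ← Finset.sum_add_distrib]
    refine Finset.sum_congr rfl fun c _ => ?_
    rw [frameConnection, frameConnection]
    ring
  have hchristoffel (k : Fin 4) : christoffel g x k i j
      = ((g x)⁻¹ *ᵥ fun l =>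
        ∑ b, d b x * coframeMatrix θ x b l * frameConnection θ γ x i b j) k := by
    rw [christoffel, Finset.mul_sum, mulVec, dotProduct]
    refine Finset.sum_congr rfl fun l _ => ?_
    rw [koszul_formula htorsion hmetric]
    ring
  rw [← congrFun (hg.coframeMatrix_mulVec_raise hx fun b => frameConnection θ γ x i b j) c,
    mulVec, dotProduct]
  exact Finset.sum_congr rfl fun k _ => by rw [hchristoffel, mul_comm]

end Coframe

/-! ### Tensor fields in a coframe -/

section Components

/-- The tensor product `θ_{A 0} ⊗ ⋯ ⊗ θ_{A (k-1)}`. -/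
def coframeTensor (θ : Fin 4 → E4 → E4 →L[ℝ] ℝ) {k : ℕ} (A : Fin k → Fin 4) : TensorField k :=
  fun x I => ∏ s, coframeMatrix θ x (A s) (I s)

/-- On `Ω` the tensor field `T` is `∑ t_A θ_{A 0} ⊗ ⋯ ⊗ θ_{A (k-1)}`. -/
def HasComponents (θ : Fin 4 → E4 → E4 →L[ℝ] ℝ) (Ω : Set E4) {k : ℕ} (T : TensorField k)
    (t : (Fin k → Fin 4) → E4 → ℝ) : Prop :=
  ∀ x ∈ Ω, ∀ I, T x I = ∑ A, t A x * coframeTensor θ A x I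

variable {g : BilinField} {θ : Fin 4 → E4 → E4 →L[ℝ] ℝ} {d : Fin 4 → E4 → ℝ}
  {τ γ : Fin 4 → Fin 4 → Fin 4 → E4 → ℝ} {Ω : Set E4} {x : E4} {k : ℕ} {T : TensorField k}
  {t : (Fin k → Fin 4) → E4 → ℝ}

theorem Diagonalizes.sum_prod_inv_mul_coframeTensor (h : Diagonalizes θ d g Ω) (hx : x ∈ Ω)
    (A B : Fin k → Fin 4) :
    ∑ I : Fin k → Fin 4, ∑ J : Fin k → Fin 4,
      (∏ s, (g x)⁻¹ (I s) (J s)) * (coframeTensor θ A x I * coframeTensor θ B x J)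
      = if A = B then ∏ s, (d (A s) x)⁻¹ else 0 := by
  have hprod : ∏ s, ∑ i, ∑ j,
        (g x)⁻¹ i j * (coframeMatrix θ x (A s) i * coframeMatrix θ x (B s) j)
      = ∑ I : Fin k → Fin 4, ∑ J : Fin k → Fin 4,
        (∏ s, (g x)⁻¹ (I s) (J s)) * (coframeTensor θ A x I * coframeTensor θ B x J) := by
    simp only [Finset.prod_univ_sum, Fintype.piFinset_univ, coframeTensor, Finset.prod_mul_distrib]
  rw [← hprod]
  simp only [h.sum_inv_mul hx]
  split_ifs with hAB
  · simp only [hAB, if_true]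
  · obtain ⟨s, hs⟩ := Function.ne_iff.1 hAB
    exact Finset.prod_eq_zero (Finset.mem_univ s) (if_neg hs)

theorem HasComponents.tensorNorm_eq (hT : HasComponents θ Ω T t) (h : Diagonalizes θ d g Ω)
    (hx : x ∈ Ω) :
    tensorNorm g T x = √(∑ A, (∏ s, (d (A s) x)⁻¹) * t A x ^ 2) := by
  rw [tensorNorm]
  congr 1
  calc _ = ∑ I : Fin k → Fin 4, ∑ J : Fin k → Fin 4, ∑ A, ∑ B, t A x * t B x *
        ((∏ s, (g x)⁻¹ (I s) (J s)) * (coframeTensor θ A x I * coframeTensor θ B x J)) := by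
        refine Finset.sum_congr rfl fun I _ => Finset.sum_congr rfl fun J _ => ?_
        rw [hT x hx, hT x hx, mul_assoc, Finset.sum_mul_sum, Finset.mul_sum]
        refine Finset.sum_congr rfl fun A _ => ?_
        rw [Finset.mul_sum]
        exact Finset.sum_congr rfl fun B _ => by ring
    _ = ∑ A, ∑ B, t A x * t B x * ∑ I : Fin k → Fin 4, ∑ J : Fin k → Fin 4,
        ((∏ s, (g x)⁻¹ (I s) (J s)) * (coframeTensor θ A x I * coframeTensor θ B x J)) := by
        simp only [Finset.mul_sum]
        conv_lhs => enter [2, I]; rw [Finset.sum_comm]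
        rw [Finset.sum_comm]
        refine Finset.sum_congr rfl fun A _ => ?_
        conv_lhs => enter [2, I]; rw [Finset.sum_comm]
        rw [Finset.sum_comm]
    _ = _ := by
        simp only [h.sum_prod_inv_mul_coframeTensor hx, mul_ite, mul_zero, Finset.sum_ite_eq,
          Finset.mem_univ, if_true]
        exact Finset.sum_congr rfl fun A _ => by ring

theorem HasComponents.tensorNorm_isBigO {w : E4 → ℝ} (hT : HasComponents θ Ω T t)
    (h : Diagonalizes θ d g Ω) (hd : ∀ a, (fun x => (d a x)⁻¹) =O[𝓟 Ω] (1 : E4 → ℝ))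
    (ht : ∀ A, t A =O[𝓟 Ω] w) : tensorNorm g T =O[𝓟 Ω] w := by
  have hsq : (fun x => ∑ A, (∏ s, (d (A s) x)⁻¹) * t A x ^ 2) =O[𝓟 Ω] fun x => w x ^ 2 := by
    refine IsBigO.fun_sum fun A _ => ?_
    have hprod : (fun x => ∏ s, (d (A s) x)⁻¹) =O[𝓟 Ω] fun _ => (1 : ℝ) := by
      simpa using IsBigO.finsetProd (s := Finset.univ) fun s _ => hd (A s)
    simpa only [one_mul] using hprod.mul ((ht A).pow 2)
  refine (hsq.sqrt (Eventually.of_forall fun x => sq_nonneg (w x))).congr' ?_ ?_ |>.of_abs_right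
  · exact eventually_principal.2 fun x hx => (hT.tensorNorm_eq h hx).symm
  · exact Eventually.of_forall fun x => Real.sqrt_sq_eq_abs (w x)

theorem coframeTensor_eq_mul (A I : Fin k → Fin 4) (s : Fin k) :
    coframeTensor θ A x I = coframeMatrix θ x (A s) (I s)
      * ∏ r ∈ Finset.univ.erase s, coframeMatrix θ x (A r) (I r) :=
  (Finset.mul_prod_erase Finset.univ _ (Finset.mem_univ s)).symm

theorem coframeTensor_update_left (A I : Fin k → Fin 4) (s : Fin k) (b : Fin 4) :
    coframeTensor θ (Function.update A s b) x I = coframeMatrix θ x b (I s)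
      * ∏ r ∈ Finset.univ.erase s, coframeMatrix θ x (A r) (I r) := by
  rw [coframeTensor_eq_mul _ _ s, Function.update_self]
  congr 1
  exact Finset.prod_congr rfl fun r hr => by rw [Function.update_of_ne (Finset.ne_of_mem_erase hr)]

theorem coframeTensor_update_right (A I : Fin k → Fin 4) (s : Fin k) (l : Fin 4) :
    coframeTensor θ A x (Function.update I s l) = coframeMatrix θ x (A s) l
      * ∏ r ∈ Finset.univ.erase s, coframeMatrix θ x (A r) (I r) := by
  rw [coframeTensor_eq_mul _ _ s, Function.update_self]
  congr 1
  exact Finset.prod_congr rfl fun r hr => by rw [Function.update_of_ne (Finset.ne_of_mem_erase hr)]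

theorem hasFDerivAt_coframeTensor
    (hθ : ∀ c i, DifferentiableAt ℝ (fun z => coframeMatrix θ z c i) x) (A I : Fin k → Fin 4) :
    HasFDerivAt (fun z => coframeTensor θ A z I)
      (∑ s, (∏ r ∈ Finset.univ.erase s, coframeMatrix θ x (A r) (I r))
        • fderiv ℝ (fun z => coframeMatrix θ z (A s) (I s)) x) x :=
  HasFDerivAt.finsetProd fun s _ => (hθ (A s) (I s)).hasFDerivAt

theorem covDeriv_coframeTensor (hγ : HasConnectionCoeffs g θ γ Ω) (hx : x ∈ Ω)
    (hθ : ∀ c i, DifferentiableAt ℝ (fun z => coframeMatrix θ z c i) x) (A : Fin k → Fin 4)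
    (I : Fin (k + 1) → Fin 4) :
    covDeriv g (coframeTensor θ A) x I = -∑ s, ∑ a, ∑ b, γ (A s) a b x *
      (coframeMatrix θ x a (I 0) * coframeTensor θ (Function.update A s b) x (Fin.tail I)) := by
  rw [covDeriv, pderiv, (hasFDerivAt_coframeTensor hθ A (Fin.tail I)).fderiv, _root_.sum_apply,
    ← Finset.sum_sub_distrib, ← Finset.sum_neg_distrib]
  refine Finset.sum_congr rfl fun s _ => ?_
  simp only [coframeTensor_update_left, coframeTensor_update_right, _root_.smul_apply,
    smul_eq_mul, ← mul_assoc, ← Finset.sum_mul]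
  rw [hγ x hx, frameConnection, pderiv]
  simp only [mul_assoc]
  ring

theorem HasComponents.covDeriv_eq_sum (hΩ : IsOpen Ω) (hT : HasComponents θ Ω T t) (hx : x ∈ Ω)
    (hθ : ∀ c i, DifferentiableAt ℝ (fun z => coframeMatrix θ z c i) x)
    (ht : ∀ A, DifferentiableAt ℝ (t A) x) (I : Fin (k + 1) → Fin 4) :
    covDeriv g T x I = ∑ A, (pderiv (I 0) (t A) x * coframeTensor θ A x (Fin.tail I)
      + t A x * covDeriv g (coframeTensor θ A) x I) := by
  have hloc : (fun z => T z (Fin.tail I)) =ᶠ[𝓝 x]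
      fun z => ∑ A, t A z * coframeTensor θ A z (Fin.tail I) :=
    eventually_of_mem (hΩ.mem_nhds hx) fun z hz => hT z hz _
  have hsum : HasFDerivAt (fun z => ∑ A, t A z * coframeTensor θ A z (Fin.tail I)) _ x :=
    HasFDerivAt.fun_sum fun A (_ : A ∈ Finset.univ) => (ht A).hasFDerivAt.mul
      (hasFDerivAt_coframeTensor hθ A (Fin.tail I)).differentiableAt.hasFDerivAt
  have hΓ : ∑ s, ∑ l, christoffel g x l (I 0) (Fin.tail I s)
        * T x (Function.update (Fin.tail I) s l)
      = ∑ A, t A x * ∑ s, ∑ l, christoffel g x l (I 0) (Fin.tail I s)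
        * coframeTensor θ A x (Function.update (Fin.tail I) s l) := by
    simp only [hT x hx, Finset.mul_sum, mul_left_comm (t _ x)]
    exact (Finset.sum_congr rfl fun s _ => Finset.sum_comm).trans Finset.sum_comm
  simp only [covDeriv]
  rw [hΓ, pderiv, hloc.fderiv_eq, hsum.fderiv]
  simp only [_root_.sum_apply, _root_.add_apply, _root_.smul_apply, smul_eq_mul, mul_sub,
    Finset.sum_add_distrib, Finset.sum_sub_distrib, pderiv]
  simp only [mul_comm, add_comm, add_sub_assoc]

theorem sum_sum_update {ι κ : Type*} [Fintype ι] [DecidableEq ι] [Fintype κ]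
    (s : ι) (f : (ι → κ) → κ → ℝ) :
    ∑ A : ι → κ, ∑ b, f (Function.update A s b) (A s) = ∑ A : ι → κ, ∑ b, f A b := by
  have hinv : Function.Involutive fun q : (ι → κ) × κ => (Function.update q.1 s q.2, q.1 s) := by
    rintro ⟨A, c⟩
    simp
  classical
  rw [← Fintype.sum_prod_type', ← Fintype.sum_prod_type']
  exact Equiv.sum_comp hinv.toPerm fun q : (ι → κ) × κ => f q.1 q.2

theorem sum_mul_covDeriv_coframeTensor (hγ : HasConnectionCoeffs g θ γ Ω) (hx : x ∈ Ω)
    (hθ : ∀ c i, DifferentiableAt ℝ (fun z => coframeMatrix θ z c i) x)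
    (t : (Fin k → Fin 4) → ℝ) (I : Fin (k + 1) → Fin 4) :
    ∑ A, t A * covDeriv g (coframeTensor θ A) x I
      = -∑ a, ∑ A : Fin k → Fin 4, (∑ s, ∑ c, γ c a (A s) x * t (Function.update A s c))
        * (coframeMatrix θ x a (I 0) * coframeTensor θ A x (Fin.tail I)) := by
  have hreindex (s : Fin k) (a : Fin 4) : ∑ A : Fin k → Fin 4, ∑ c,
        γ c a (A s) x * t (Function.update A s c) * coframeTensor θ A x (Fin.tail I)
      = ∑ A : Fin k → Fin 4, ∑ b, γ (A s) a b x * t A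
        * coframeTensor θ (Function.update A s b) x (Fin.tail I) := by
    rw [← sum_sum_update s]
    refine Finset.sum_congr rfl fun A _ => Finset.sum_congr rfl fun b _ => ?_
    rw [Function.update_self, Function.update_idem, Function.update_eq_self]
  simp only [covDeriv_coframeTensor hγ hx hθ, mul_neg, Finset.sum_neg_distrib]
  congr 1
  calc _ = ∑ a, coframeMatrix θ x a (I 0) * ∑ s, ∑ A : Fin k → Fin 4, ∑ b,
        γ (A s) a b x * t A * coframeTensor θ (Function.update A s b) x (Fin.tail I) := by
        simp only [Finset.mul_sum]
        refine (Finset.sum_congr rfl fun A _ => Finset.sum_comm).trans (Finset.sum_comm.trans ?_)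
        refine Finset.sum_congr rfl fun a _ => Finset.sum_comm.trans ?_
        exact Finset.sum_congr rfl fun s _ => Finset.sum_congr rfl fun A _ =>
          Finset.sum_congr rfl fun b _ => by ring
    _ = ∑ a, coframeMatrix θ x a (I 0) * ∑ A : Fin k → Fin 4, ∑ s, ∑ c,
        γ c a (A s) x * t (Function.update A s c) * coframeTensor θ A x (Fin.tail I) := by
        simp only [← hreindex]
        exact Finset.sum_congr rfl fun a _ => congrArg _ Finset.sum_comm
    _ = _ := by simp only [Finset.mul_sum, Finset.sum_mul, mul_left_comm]

theorem HasComponents.covDeriv {t' : (Fin k → Fin 4) → Fin 4 → E4 → ℝ} (hΩ : IsOpen Ω)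
    (hθ : HasStructureCoeffs θ τ Ω) (hγ : HasConnectionCoeffs g θ γ Ω) (hT : HasComponents θ Ω T t)
    (ht : ∀ x ∈ Ω, ∀ A, HasFDerivAt (t A) (∑ a, t' A a x • θ a x) x) :
    HasComponents θ Ω (covDeriv g T) fun A x => t' (Fin.tail A) (A 0) x
      - ∑ s : Fin k, ∑ c, γ c (A 0) (Fin.tail A s) x * t (Function.update (Fin.tail A) s c) x := by
  intro x hx I
  have hθx := hθ.differentiableAt x hx
  have hderiv : ∑ A, (∑ a, t' A a x * coframeMatrix θ x a (I 0)) * coframeTensor θ A x (Fin.tail I)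
      = ∑ a, ∑ A, t' A a x
        * (coframeMatrix θ x a (I 0) * coframeTensor θ A x (Fin.tail I)) := by
    simp only [Finset.sum_mul, mul_assoc]
    exact Finset.sum_comm
  have hcons (a : Fin 4) (A : Fin k → Fin 4) :
      coframeTensor θ ((Fin.consEquiv fun _ => Fin 4) (a, A)) x I
        = coframeMatrix θ x a (I 0) * coframeTensor θ A x (Fin.tail I) :=
    Fin.prod_univ_succ _
  have hhead (a : Fin 4) (A : Fin k → Fin 4) : (Fin.consEquiv fun _ => Fin 4) (a, A) 0 = a := rfl
  have htail (a : Fin 4) (A : Fin k → Fin 4) :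
      Fin.tail ((Fin.consEquiv fun _ => Fin 4) (a, A)) = A := rfl
  rw [hT.covDeriv_eq_sum hΩ hx hθx fun A => (ht x hx A).differentiableAt,
    ← (Fin.consEquiv fun _ => Fin 4).sum_comp, Fintype.sum_prod_type]
  simp only [hcons, hhead, htail, pderiv_eq_sum (ht x hx _), Finset.sum_add_distrib, hderiv,
    sum_mul_covDeriv_coframeTensor hγ hx hθx, ← sub_eq_add_neg, sub_mul, Finset.sum_sub_distrib]

theorem HasComponents.exists_covDeriv_isSymbol {w : E4 → ℝ} {n : ℕ} (hΩ : IsOpen Ω)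
    (hθ : HasStructureCoeffs θ τ Ω) (hγ : HasConnectionCoeffs g θ γ Ω)
    (hγ_symbol : ∀ c a b, IsSymbol θ Ω 1 n (γ c a b)) (hT : HasComponents θ Ω T t)
    (ht : ∀ A, IsSymbol θ Ω w (n + 1) (t A)) :
    ∃ t', HasComponents θ Ω (TaubNUT.covDeriv g T) t' ∧ ∀ A, IsSymbol θ Ω w n (t' A) := by
  choose t' hd ht' using fun A => (ht A).2
  refine ⟨_, hT.covDeriv hΩ hθ hγ fun x hx A => hd A x hx, fun A => (ht' _ _).sub ?_⟩
  refine IsSymbol.sum _ fun s _ => IsSymbol.sum _ fun c _ => ?_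
  simpa only [one_mul] using (hγ_symbol c (A 0) (Fin.tail A s)).mul (ht _).of_succ

theorem HasComponents.exists_iterCovDeriv_isSymbol {w : E4 → ℝ} (hΩ : IsOpen Ω)
    (hθ : HasStructureCoeffs θ τ Ω) (hγ : HasConnectionCoeffs g θ γ Ω)
    (hγ_symbol : ∀ n c a b, IsSymbol θ Ω 1 n (γ c a b)) (hT : HasComponents θ Ω T t)
    (ℓ n : ℕ) (ht : ∀ A, IsSymbol θ Ω w (n + ℓ) (t A)) :
    ∃ t', HasComponents θ Ω (iterCovDeriv g T ℓ) t' ∧ ∀ A, IsSymbol θ Ω w n (t' A) := by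
  induction ℓ generalizing n with
  | zero => exact ⟨t, hT, ht⟩
  | succ ℓ ih =>
    obtain ⟨t', hT', ht'⟩ := ih (n + 1) (by rwa [add_assoc, add_comm 1])
    exact hT'.exists_covDeriv_isSymbol hΩ hθ hγ (hγ_symbol n) ht'

end Components

/-! ### Smooth tensor fields -/

section Smooth

variable {g : BilinField}

theorem contDiff_pderiv {F : E4 → ℝ} (hF : ContDiff ℝ ∞ F) (i : Fin 4) :
    ContDiff ℝ ∞ (pderiv i F) :=
  (hF.fderiv_right (m := ∞) le_rfl).clm_apply contDiff_const

theorem contDiff_christoffel (hg : ∀ i j, ContDiff ℝ ∞ fun x => g x i j)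
    (hdet : ∀ x, (g x).det ≠ 0) (k i j : Fin 4) :
    ContDiff ℝ ∞ fun x => christoffel g x k i j := by
  refine contDiff_const.mul (ContDiff.sum fun l _ => (contDiff_matrix_inv hg hdet k l).mul ?_)
  exact ((contDiff_pderiv (hg j l) i).add (contDiff_pderiv (hg i l) j)).sub
    (contDiff_pderiv (hg i j) l)

theorem contDiff_covDeriv (hg : ∀ i j, ContDiff ℝ ∞ fun x => g x i j)
    (hdet : ∀ x, (g x).det ≠ 0) {k : ℕ} {T : TensorField k}
    (hT : ∀ I, ContDiff ℝ ∞ fun x => T x I) (I : Fin (k + 1) → Fin 4) :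
    ContDiff ℝ ∞ fun x => covDeriv g T x I :=
  (contDiff_pderiv (hT _) _).sub <| ContDiff.sum fun _ _ => ContDiff.sum fun _ _ =>
    (contDiff_christoffel hg hdet _ _ _).mul (hT _)

theorem contDiff_iterCovDeriv (hg : ∀ i j, ContDiff ℝ ∞ fun x => g x i j)
    (hdet : ∀ x, (g x).det ≠ 0) {k : ℕ} {T : TensorField k}
    (hT : ∀ I, ContDiff ℝ ∞ fun x => T x I) :
    ∀ (ℓ : ℕ) (I : Fin (k + ℓ) → Fin 4), ContDiff ℝ ∞ fun x => iterCovDeriv g T ℓ x I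
  | 0 => hT
  | ℓ + 1 => contDiff_covDeriv hg hdet (contDiff_iterCovDeriv hg hdet hT ℓ)

theorem continuous_tensorNorm (hg : ∀ i j, Continuous fun x => g x i j)
    (hdet : ∀ x, (g x).det ≠ 0) {k : ℕ} {T : TensorField k}
    (hT : ∀ I, Continuous fun x => T x I) : Continuous (tensorNorm g T) := by
  refine Real.continuous_sqrt.comp ?_
  refine continuous_finsetSum _ fun I _ => continuous_finsetSum _ fun J _ => ?_
  refine (Continuous.mul ?_ (hT I)).mul (hT J)
  exact continuous_finsetProd _ fun s _ =>
    (contDiff_matrix_inv (fun i j => contDiff_zero.2 (hg i j)) hdet _ _).continuous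

theorem contDiff_pullback {F : E4 → E4} (hF : ContDiff ℝ ∞ F)
    (hg : ∀ i j, ContDiff ℝ ∞ fun x => g x i j) (i j : Fin 4) :
    ContDiff ℝ ∞ fun x => pullback F g x i j := by
  have hcoord (i k : Fin 4) : ContDiff ℝ ∞ fun x => (fderiv ℝ F x (basisVec i)) k :=
    (EuclideanSpace.proj (𝕜 := ℝ) k).contDiff.comp
      ((hF.fderiv_right (m := ∞) le_rfl).clm_apply contDiff_const)
  simp only [pullback, of_apply]
  exact ContDiff.sum fun k _ => ContDiff.sum fun l _ =>
    (((hg k l).comp hF).mul (hcoord i k)).mul (hcoord j l)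

end Smooth

/-! ### Taub-NUT geometry -/

theorem norm_z₁_sq (x : E4) : ‖z₁ x‖ ^ 2 = x 0 ^ 2 + x 1 ^ 2 := by
  rw [← Complex.normSq_eq_norm_sq, Complex.normSq_apply, z₁]
  ring

theorem norm_z₂_sq (x : E4) : ‖z₂ x‖ ^ 2 = x 2 ^ 2 + x 3 ^ 2 := by
  rw [← Complex.normSq_eq_norm_sq, Complex.normSq_apply, z₂]
  ring

theorem norm_sq_eq (x : E4) : ‖x‖ ^ 2 = ‖z₁ x‖ ^ 2 + ‖z₂ x‖ ^ 2 := by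
  rw [EuclideanSpace.real_norm_sq_eq, Fin.sum_univ_four, norm_z₁_sq, norm_z₂_sq]
  ring

/-- The weight `e^{-4 m y₁}`, for which `u² = e^{-4 m y₁} |z₁|²`. -/
def P (m : ℝ) (x : E4) : ℝ := Real.exp (-(4 * m * y m 0 x))

/-- The weight `e^{4 m y₁}`, for which `v² = e^{4 m y₁} |z₂|²`. -/
def Q (m : ℝ) (x : E4) : ℝ := Real.exp (4 * m * y m 0 x)

theorem P_pos (m : ℝ) (x : E4) : 0 < P m x := Real.exp_pos _

theorem Q_pos (m : ℝ) (x : E4) : 0 < Q m x := Real.exp_pos _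

theorem P_mul_Q (m : ℝ) (x : E4) : P m x * Q m x = 1 := by
  rw [P, Q, ← Real.exp_add, neg_add_cancel, Real.exp_zero]

theorem four_mul_y_zero (m : ℝ) (x : E4) :
    4 * m * y m 0 x = 2 * (m * ((uv m x).1 ^ 2 - (uv m x).2 ^ 2)) := by
  simp only [y, cons_val_zero]
  ring

theorem uv_fst_sq {m : ℝ} (hm : 0 < m) (x : E4) : (uv m x).1 ^ 2 = P m x * ‖z₁ x‖ ^ 2 := by
  rw [(isLeBrunPair_uv hm x).1, mul_pow, ← Real.exp_nat_mul, Nat.cast_two, P, four_mul_y_zero,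
    ← mul_assoc, ← Real.exp_add, neg_add_cancel, Real.exp_zero, one_mul]

theorem uv_snd_sq {m : ℝ} (hm : 0 < m) (x : E4) : (uv m x).2 ^ 2 = Q m x * ‖z₂ x‖ ^ 2 := by
  rw [(isLeBrunPair_uv hm x).2, mul_pow, ← Real.exp_nat_mul, Nat.cast_two, Q, four_mul_y_zero,
    ← mul_assoc, ← Real.exp_add, ← mul_add, ← mul_add, sub_add_sub_cancel, sub_self, mul_zero,
    mul_zero, Real.exp_zero, one_mul]

theorem two_mul_y_zero {m : ℝ} (hm : 0 < m) (x : E4) :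
    2 * y m 0 x = P m x * ‖z₁ x‖ ^ 2 - Q m x * ‖z₂ x‖ ^ 2 := by
  rw [← uv_fst_sq hm, ← uv_snd_sq hm]
  simp only [y, cons_val_zero]
  ring

theorem two_mul_R {m : ℝ} (hm : 0 < m) (x : E4) :
    2 * R m x = P m x * ‖z₁ x‖ ^ 2 + Q m x * ‖z₂ x‖ ^ 2 := by
  rw [← uv_fst_sq hm, ← uv_snd_sq hm, R]
  ring

theorem y_one (m : ℝ) (x : E4) : y m 1 x = x 0 * x 3 + x 1 * x 2 := by
  simp [y, z₁, z₂]

theorem y_two (m : ℝ) (x : E4) : y m 2 x = x 1 * x 3 - x 0 * x 2 := by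
  simp only [y, one_div, z₁, neg_mul, z₂, Complex.neg_re, Complex.mul_re, Complex.I_re, zero_mul,
    Complex.I_im, one_mul, zero_sub, Complex.mul_im, zero_add, neg_sub, sub_neg_eq_add,
    Complex.neg_im, neg_add_rev, neg_neg, cons_val', cons_val_fin_one, cons_val, cons_val_one]
  ring

theorem y_one_sq_add_y_two_sq (m : ℝ) (x : E4) :
    y m 1 x ^ 2 + y m 2 x ^ 2 = ‖z₁ x‖ ^ 2 * ‖z₂ x‖ ^ 2 := by
  rw [y_one, y_two, norm_z₁_sq, norm_z₂_sq]
  ring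

theorem R_sq {m : ℝ} (hm : 0 < m) (x : E4) :
    R m x ^ 2 = y m 0 x ^ 2 + y m 1 x ^ 2 + y m 2 x ^ 2 := by
  have hR : R m x = (P m x * ‖z₁ x‖ ^ 2 + Q m x * ‖z₂ x‖ ^ 2) / 2 := by
    linarith [two_mul_R hm x]
  have hy : y m 0 x = (P m x * ‖z₁ x‖ ^ 2 - Q m x * ‖z₂ x‖ ^ 2) / 2 := by
    linarith [two_mul_y_zero hm x]
  rw [add_assoc, y_one_sq_add_y_two_sq, hR, hy]
  linear_combination ‖z₁ x‖ ^ 2 * ‖z₂ x‖ ^ 2 * P_mul_Q m x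

theorem R_nonneg (m : ℝ) (x : E4) : 0 ≤ R m x := by
  unfold R
  positivity

theorem eq_zero_of_weighted_norm_eq_zero {m : ℝ} {x X : E4}
    (h : P m x * ‖z₁ X‖ ^ 2 + Q m x * ‖z₂ X‖ ^ 2 = 0) : X = 0 := by
  rw [add_eq_zero_iff_of_nonneg (mul_nonneg (P_pos m x).le (sq_nonneg _))
    (mul_nonneg (Q_pos m x).le (sq_nonneg _)), mul_eq_zero_iff_left (P_pos m x).ne',
    mul_eq_zero_iff_left (Q_pos m x).ne'] at h
  have hX : ‖X‖ ^ 2 = 0 := by rw [norm_sq_eq, h.1, h.2, add_zero]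
  exact norm_eq_zero.1 (pow_eq_zero_iff two_ne_zero |>.1 hX)

theorem R_pos {m : ℝ} (hm : 0 < m) {x : E4} (hx : x ≠ 0) : 0 < R m x := by
  refine (R_nonneg m x).lt_of_ne' fun hR => hx ?_
  exact eq_zero_of_weighted_norm_eq_zero (x := x) (by rw [← two_mul_R hm, hR, mul_zero])

theorem one_add_pos {m : ℝ} (hm : 0 < m) (x : E4) : 0 < 1 + 4 * m * R m x := by
  have := R_nonneg m x
  positivity

theorem abs_y_le {m : ℝ} (hm : 0 < m) (i : Fin 3) (x : E4) : |y m i x| ≤ R m x := by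
  refine abs_le_of_sq_le_sq ?_ (R_nonneg m x)
  rw [R_sq hm, ← Fin.sum_univ_three fun i => y m i x ^ 2]
  exact Finset.single_le_sum (fun j _ => sq_nonneg (y m j x)) (Finset.mem_univ i)

theorem eq_y_zero {m : ℝ} (hm : 0 < m) {x : E4} {t : ℝ}
    (h : 2 * t = Real.exp (-(4 * m * t)) * ‖z₁ x‖ ^ 2 - Real.exp (4 * m * t) * ‖z₂ x‖ ^ 2) :
    t = y m 0 x := by
  set p : ℝ × ℝ := (Real.exp (-(2 * m * t)) * ‖z₁ x‖, Real.exp (2 * m * t) * ‖z₂ x‖) with hp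
  have hpt : p.1 ^ 2 - p.2 ^ 2 = 2 * t := by
    rw [h, hp]
    simp only [mul_pow, ← Real.exp_nat_mul, Nat.cast_ofNat]
    ring_nf
  have hpair : IsLeBrunPair m x p := by
    constructor
    · rw [hpt, hp, ← mul_assoc, ← Real.exp_add]
      ring_nf
      rw [Real.exp_zero, one_mul]
    · rw [← neg_sub, hpt, hp, ← mul_assoc, ← Real.exp_add]
      ring_nf
      rw [Real.exp_zero, one_mul]
  rw [(existsUnique_isLeBrunPair hm x).unique hpair (isLeBrunPair_uv hm x)] at hpt
  simp only [y, cons_val_zero, hpt]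
  ring

/-- The function `2t - e^{-4mt} |z₁|² + e^{4mt} |z₂|²`, whose only root in `t` is `y₁`. -/
def implicitFun (m : ℝ) (p : E4 × ℝ) : ℝ :=
  2 * p.2 - Real.exp (-(4 * m * p.2)) * (p.1 0 ^ 2 + p.1 1 ^ 2)
    + Real.exp (4 * m * p.2) * (p.1 2 ^ 2 + p.1 3 ^ 2)

theorem implicitFun_eq_zero_iff {m : ℝ} (hm : 0 < m) (x : E4) (t : ℝ) :
    implicitFun m (x, t) = 0 ↔ t = y m 0 x := by
  simp only [implicitFun, ← norm_z₁_sq, ← norm_z₂_sq]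
  refine ⟨fun h => eq_y_zero hm (by linarith), ?_⟩
  rintro rfl
  have := two_mul_y_zero hm x
  simp only [P, Q] at this
  linarith

theorem contDiff_implicitFun (m : ℝ) : ContDiff ℝ ∞ (implicitFun m) := by
  unfold implicitFun
  fun_prop

theorem hasDerivAt_implicitFun {m : ℝ} (hm : 0 < m) (x : E4) :
    HasDerivAt (fun t => implicitFun m (x, t)) (2 * (1 + 4 * m * R m x)) (y m 0 x) := by
  have hlin := (hasDerivAt_id (y m 0 x)).const_mul (4 * m)
  refine ((((hasDerivAt_id (y m 0 x)).const_mul 2).sub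
    (hlin.neg.exp.mul_const (x 0 ^ 2 + x 1 ^ 2))).add
      (hlin.exp.mul_const (x 2 ^ 2 + x 3 ^ 2))).congr_deriv ?_
  have hR := two_mul_R hm x
  rw [norm_z₁_sq, norm_z₂_sq] at hR
  simp only [P, Q] at hR
  simp only [id]
  linear_combination -4 * m * hR

theorem contDiff_y_zero {m : ℝ} (hm : 0 < m) : ContDiff ℝ ∞ (y m 0) := by
  rw [contDiff_iff_contDiffAt]
  intro x
  have hne : (∞ : WithTop ℕ∞) ≠ 0 := by simp
  have hf : ContDiffAt ℝ ∞ (implicitFun m) (x, y m 0 x) := (contDiff_implicitFun m).contDiffAt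
  have hinv : (fderiv ℝ (implicitFun m) (x, y m 0 x) ∘L .inr ℝ E4 ℝ).IsInvertible := by
    have hpartial := ((hf.differentiableAt hne).hasFDerivAt.comp (y m 0 x)
      (hasFDerivAt_prodMk_right x (y m 0 x))).unique (hasDerivAt_implicitFun hm x).hasFDerivAt
    rw [hpartial]
    have hpos := one_add_pos hm x
    refine ⟨ContinuousLinearEquiv.unitsEquivAut ℝ
      (Units.mk0 (2 * (1 + 4 * m * R m x)) (by positivity)), ?_⟩
    ext
    simp
  refine (hf.contDiffAt_implicitFunction hne hinv).congr_of_eventuallyEq ?_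
  filter_upwards [hf.eventually_apply_implicitFunction hne hinv] with z hz
  rw [(implicitFun_eq_zero_iff hm x _).2 rfl, implicitFun_eq_zero_iff hm] at hz
  exact hz.symm

theorem contDiff_P {m : ℝ} (hm : 0 < m) : ContDiff ℝ ∞ (P m) := by
  have := contDiff_y_zero hm
  unfold P
  fun_prop

theorem contDiff_Q {m : ℝ} (hm : 0 < m) : ContDiff ℝ ∞ (Q m) := by
  have := contDiff_y_zero hm
  unfold Q
  fun_prop

theorem contDiff_R {m : ℝ} (hm : 0 < m) : ContDiff ℝ ∞ (R m) := by
  have hR : R m = fun x =>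
      (1 / 2) * (P m x * (x 0 ^ 2 + x 1 ^ 2) + Q m x * (x 2 ^ 2 + x 3 ^ 2)) := by
    ext x
    rw [← norm_z₁_sq, ← norm_z₂_sq, ← two_mul_R hm]
    ring
  have hP := contDiff_P hm
  have hQ := contDiff_Q hm
  rw [hR]
  fun_prop

/-- The coordinate form `dxᵢ`. -/
abbrev dx (i : Fin 4) : E4 →L[ℝ] ℝ := EuclideanSpace.proj i

/-- The form `|z₁| d|z₁|`. -/
def rad₁ (x : E4) : E4 →L[ℝ] ℝ := x 0 • dx 0 + x 1 • dx 1

/-- The form `|z₂| d|z₂|`. -/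
def rad₂ (x : E4) : E4 →L[ℝ] ℝ := x 2 • dx 2 + x 3 • dx 3

/-- The form `|z₁|² d(arg z₁)`. -/
def rot₁ (x : E4) : E4 →L[ℝ] ℝ := x 0 • dx 1 - x 1 • dx 0

/-- The form `|z₂|² d(arg z₂)`. -/
def rot₂ (x : E4) : E4 →L[ℝ] ℝ := x 2 • dx 3 - x 3 • dx 2

/-- The form `(1 + 4mR) dy₁`. -/
def radialDiff (m : ℝ) (x : E4) : E4 →L[ℝ] ℝ := P m x • rad₁ x - Q m x • rad₂ x

/-- The form `dR + 4 m y₁ dy₁`. -/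
def radialSum (m : ℝ) (x : E4) : E4 →L[ℝ] ℝ := P m x • rad₁ x + Q m x • rad₂ x

/-- The form `2Rη`. -/
def angularDiff (m : ℝ) (x : E4) : E4 →L[ℝ] ℝ := P m x • rot₁ x - Q m x • rot₂ x

/-- The form `R⁻¹ (y₁ · 2Rη + y₂ dy₃ - y₃ dy₂)`, which occurs in the differential of `2Rη`. -/
def angularSum (m : ℝ) (x : E4) : E4 →L[ℝ] ℝ := P m x • rot₁ x + Q m x • rot₂ x

/-- The coframe `dy₁, dy₂, dy₃, η` on `ℝ⁴ ∖ {0}`. -/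
def coframe (m : ℝ) : Fin 4 → E4 → E4 →L[ℝ] ℝ :=
  ![fun x => (1 + 4 * m * R m x)⁻¹ • radialDiff m x,
    fun x => x 0 • dx 3 + x 3 • dx 0 + (x 1 • dx 2 + x 2 • dx 1),
    fun x => x 1 • dx 3 + x 3 • dx 1 - (x 0 • dx 2 + x 2 • dx 0),
    fun x => (2 * R m x)⁻¹ • angularDiff m x]

theorem rad₁_apply (x X : E4) : rad₁ x X = x 0 * X 0 + x 1 * X 1 := rfl

theorem rad₂_apply (x X : E4) : rad₂ x X = x 2 * X 2 + x 3 * X 3 := rfl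

theorem rot₁_apply (x X : E4) : rot₁ x X = x 0 * X 1 - x 1 * X 0 := rfl

theorem rot₂_apply (x X : E4) : rot₂ x X = x 2 * X 3 - x 3 * X 2 := rfl

theorem radialDiff_apply (m : ℝ) (x X : E4) :
    radialDiff m x X = P m x * rad₁ x X - Q m x * rad₂ x X := rfl

theorem radialSum_apply (m : ℝ) (x X : E4) :
    radialSum m x X = P m x * rad₁ x X + Q m x * rad₂ x X := rfl

theorem angularDiff_apply (m : ℝ) (x X : E4) :
    angularDiff m x X = P m x * rot₁ x X - Q m x * rot₂ x X := rfl

theorem angularSum_apply (m : ℝ) (x X : E4) :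
    angularSum m x X = P m x * rot₁ x X + Q m x * rot₂ x X := rfl

theorem coframe_zero_apply (m : ℝ) (x X : E4) :
    coframe m 0 x X = (1 + 4 * m * R m x)⁻¹ * radialDiff m x X := rfl

theorem coframe_one_apply (m : ℝ) (x X : E4) :
    coframe m 1 x X = x 0 * X 3 + x 3 * X 0 + (x 1 * X 2 + x 2 * X 1) := rfl

theorem coframe_two_apply (m : ℝ) (x X : E4) :
    coframe m 2 x X = x 1 * X 3 + x 3 * X 1 - (x 0 * X 2 + x 2 * X 0) := rfl

theorem coframe_three_apply (m : ℝ) (x X : E4) :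
    coframe m 3 x X = (2 * R m x)⁻¹ * angularDiff m x X := rfl

theorem hasFDerivAt_coord (i : Fin 4) (x : E4) : HasFDerivAt (fun x : E4 => x i) (dx i) x :=
  (dx i).hasFDerivAt

theorem hasFDerivAt_norm_z₁_sq (x : E4) :
    HasFDerivAt (fun x => ‖z₁ x‖ ^ 2) ((2 : ℝ) • rad₁ x) x := by
  simp only [norm_z₁_sq]
  refine (((hasFDerivAt_coord 0 x).pow 2).add ((hasFDerivAt_coord 1 x).pow 2)).congr_fderiv ?_
  ext X
  simp only [Nat.add_one_sub_one, pow_one, nsmul_eq_mul, Nat.cast_ofNat, _root_.add_apply,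
    _root_.smul_apply, PiLp.proj_apply, smul_eq_mul, rad₁, smul_add]
  ring

theorem hasFDerivAt_norm_z₂_sq (x : E4) :
    HasFDerivAt (fun x => ‖z₂ x‖ ^ 2) ((2 : ℝ) • rad₂ x) x := by
  simp only [norm_z₂_sq]
  refine (((hasFDerivAt_coord 2 x).pow 2).add ((hasFDerivAt_coord 3 x).pow 2)).congr_fderiv ?_
  ext X
  simp only [Nat.add_one_sub_one, pow_one, nsmul_eq_mul, Nat.cast_ofNat, _root_.add_apply,
    _root_.smul_apply, PiLp.proj_apply, smul_eq_mul, rad₂, smul_add]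
  ring

theorem hasFDerivAt_y_zero {m : ℝ} (hm : 0 < m) (x : E4) :
    HasFDerivAt (y m 0) (coframe m 0 x) x := by
  have hL := ((contDiff_y_zero hm).differentiable (by simp) x).hasFDerivAt
  set L := fderiv ℝ (y m 0) x
  have hweight := hL.const_mul (4 * m)
  have hy : (fun x => 2 * y m 0 x) = fun x : E4 => Real.exp (-(4 * m * y m 0 x)) * ‖z₁ x‖ ^ 2
      - Real.exp (4 * m * y m 0 x) * ‖z₂ x‖ ^ 2 := funext (two_mul_y_zero hm)
  have hrhs := (hweight.fun_neg.exp.mul (hasFDerivAt_norm_z₁_sq x)).sub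
    (hweight.exp.mul (hasFDerivAt_norm_z₂_sq x))
  have huniq := (hL.const_mul 2).unique (hrhs.congr_of_eventuallyEq (.of_forall (congrFun hy)))
  refine hL.congr_fderiv (ContinuousLinearMap.ext fun X => ?_)
  have hX := DFunLike.congr_fun huniq X
  simp only [_root_.sub_apply, _root_.add_apply, _root_.smul_apply, _root_.neg_apply,
    smul_eq_mul] at hX
  have hR := two_mul_R hm x
  rw [coframe_zero_apply, radialDiff_apply, eq_comm, inv_mul_eq_iff_eq_mul₀ (one_add_pos hm x).ne']
  simp only [P, Q] at hR ⊢
  linear_combination (-1 / 2) * hX - 2 * m * L X * hR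

theorem hasFDerivAt_y {m : ℝ} (hm : 0 < m) (i : Fin 3) (x : E4) :
    HasFDerivAt (y m i) (coframe m i.castSucc x) x := by
  have hcoord := fun i => hasFDerivAt_coord i x
  fin_cases i
  · exact hasFDerivAt_y_zero hm x
  · exact (((hcoord 0).mul (hcoord 3)).add ((hcoord 1).mul (hcoord 2))).congr_of_eventuallyEq
      (.of_forall (y_one m))
  · exact (((hcoord 1).mul (hcoord 3)).sub ((hcoord 0).mul (hcoord 2))).congr_of_eventuallyEq
      (.of_forall (y_two m))

theorem contDiff_y {m : ℝ} (hm : 0 < m) (i : Fin 3) : ContDiff ℝ ∞ (y m i) := by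
  fin_cases i
  · exact contDiff_y_zero hm
  · change ContDiff ℝ ∞ (y m 1)
    rw [funext (y_one m)]
    fun_prop
  · change ContDiff ℝ ∞ (y m 2)
    rw [funext (y_two m)]
    fun_prop

theorem V_eq {m : ℝ} (hm : 0 < m) {x : E4} (hx : x ≠ 0) : V m x = 2 * m + (2 * R m x)⁻¹ := by
  have := R_pos hm hx
  rw [V]
  field_simp
  ring

theorem V_pos {m : ℝ} (hm : 0 < m) {x : E4} (hx : x ≠ 0) : 0 < V m x :=
  div_pos (one_add_pos hm x) (mul_pos two_pos (R_pos hm hx))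

theorem η_eq {m : ℝ} (hm : 0 < m) {x : E4} (hx : x ≠ 0) (X : E4) : η m x X = coframe m 3 x X := by
  have hR := R_pos hm hx
  have := one_add_pos hm x
  rw [η, (hasFDerivAt_y_zero hm x).fderiv, coframe_zero_apply, coframe_three_apply, V]
  have hI : radialDiff m x (I₁ X) = -angularDiff m x X := by
    simp only [I₁, radialDiff_apply, rad₁_apply, cons_val_zero, cons_val_one, rad₂_apply, cons_val,
      angularDiff_apply, rot₁_apply, rot₂_apply]
    ring
  rw [hI]
  field_simp

/-- The coefficients `V, V, V, V⁻¹` of the Taub-NUT metric in the coframe. -/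
def diagCoeff (m : ℝ) : Fin 4 → E4 → ℝ :=
  ![V m, V m, V m, fun x => (V m x)⁻¹]

theorem diagCoeff_pos {m : ℝ} (hm : 0 < m) {x : E4} (hx : x ≠ 0) (a : Fin 4) :
    0 < diagCoeff m a x := by
  have := V_pos hm hx
  fin_cases a <;> simpa [diagCoeff]

theorem taubNUT_apply {m : ℝ} (hm : 0 < m) {x : E4} (hx : x ≠ 0) (i j : Fin 4) :
    taubNUT m x i j = ∑ a, diagCoeff m a x *
      (coframe m a x (basisVec i) * coframe m a x (basisVec j)) := by
  rw [taubNUT, if_neg hx, Matrix.of_apply, η_eq hm hx, η_eq hm hx, Finset.mul_sum,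
    Fin.sum_univ_castSucc (n := 3)]
  simp only [pderiv, (hasFDerivAt_y hm _ x).fderiv]
  rfl

theorem sum_forms_eq {m : ℝ} (hm : 0 < m) (x X Y : E4) :
    coframe m 1 x X * coframe m 1 x Y + coframe m 2 x X * coframe m 2 x Y
        + radialDiff m x X * radialDiff m x Y + angularDiff m x X * angularDiff m x Y
      = 2 * R m x * (P m x * (X 0 * Y 0 + X 1 * Y 1) + Q m x * (X 2 * Y 2 + X 3 * Y 3)) := by
  rw [two_mul_R hm, norm_z₁_sq, norm_z₂_sq]
  simp only [coframe_one_apply, coframe_two_apply, radialDiff_apply, angularDiff_apply,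
    rad₁_apply, rad₂_apply, rot₁_apply, rot₂_apply]
  linear_combination
    -((x 0 ^ 2 + x 1 ^ 2) * (X 2 * Y 2 + X 3 * Y 3) + (x 2 ^ 2 + x 3 ^ 2) * (X 0 * Y 0 + X 1 * Y 1)
      + (x 0 * X 0 + x 1 * X 1) * (x 2 * Y 2 + x 3 * Y 3)
      + (x 0 * Y 0 + x 1 * Y 1) * (x 2 * X 2 + x 3 * X 3)
      + (x 0 * X 1 - x 1 * X 0) * (x 2 * Y 3 - x 3 * Y 2)
      + (x 0 * Y 1 - x 1 * Y 0) * (x 2 * X 3 - x 3 * X 2)) * P_mul_Q m x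

/-- The pairing `f(X, Y)` of the Taub-NUT metric, written without division by `R`. -/
def taubNUTPairing (m : ℝ) (x X Y : E4) : ℝ :=
  P m x * (X 0 * Y 0 + X 1 * Y 1) + Q m x * (X 2 * Y 2 + X 3 * Y 3)
    + 2 * m * (coframe m 1 x X * coframe m 1 x Y + coframe m 2 x X * coframe m 2 x Y)
    - 2 * m * (1 + 4 * m * R m x)⁻¹ *
      (radialDiff m x X * radialDiff m x Y + angularDiff m x X * angularDiff m x Y)

theorem taubNUTPairing_eq {m : ℝ} (hm : 0 < m) {x : E4} (hx : x ≠ 0) (X Y : E4) :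
    taubNUTPairing m x X Y = ∑ a, diagCoeff m a x * (coframe m a x X * coframe m a x Y) := by
  have hR := R_pos hm hx
  have := one_add_pos hm x
  simp only [taubNUTPairing, Fin.sum_univ_four, diagCoeff, cons_val, V, coframe_zero_apply,
    coframe_three_apply]
  field_simp
  linear_combination -(1 + 4 * m * R m x) * sum_forms_eq hm x X Y

theorem taubNUT_eq_pairing {m : ℝ} (hm : 0 < m) (x : E4) (i j : Fin 4) :
    taubNUT m x i j = taubNUTPairing m x (basisVec i) (basisVec j) := by
  by_cases hx : x = 0
  · subst hx
    have hy : y m 0 0 = 0 := by simpa [norm_z₁_sq, norm_z₂_sq] using two_mul_y_zero hm 0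
    have hP : P m 0 = 1 := by simp [P, hy]
    have hQ : Q m 0 = 1 := by simp [Q, hy]
    rw [taubNUT, if_pos rfl, taubNUTPairing]
    simp only [hP, hQ, coframe_one_apply, coframe_two_apply, radialDiff_apply, angularDiff_apply,
      rad₁_apply, rad₂_apply, rot₁_apply, rot₂_apply]
    fin_cases i <;> fin_cases j <;> simp [basisVec]
  · rw [taubNUT_apply hm hx, taubNUTPairing_eq hm hx]

theorem contDiff_taubNUT {m : ℝ} (hm : 0 < m) (i j : Fin 4) :
    ContDiff ℝ ∞ fun x => taubNUT m x i j := by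
  have hP := contDiff_P hm
  have hQ := contDiff_Q hm
  have hR := contDiff_R hm
  have hinv : ContDiff ℝ ∞ fun x => (1 + 4 * m * R m x)⁻¹ :=
    ContDiff.inv (by fun_prop) fun x => (one_add_pos hm x).ne'
  simp only [taubNUT_eq_pairing hm, taubNUTPairing, coframe_one_apply, coframe_two_apply,
    radialDiff_apply, angularDiff_apply, rad₁_apply, rad₂_apply, rot₁_apply, rot₂_apply]
  fun_prop

theorem apply_eq_sum_basisVec (β : E4 →L[ℝ] ℝ) (X : E4) : β X = ∑ i, X i * β (basisVec i) := by
  conv_lhs => rw [← (EuclideanSpace.basisFun (Fin 4) ℝ).sum_repr X]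
  simp [basisVec]

theorem isUnit_det_coframe {m : ℝ} (hm : 0 < m) {x : E4} (hx : x ≠ 0) :
    IsUnit (coframeMatrix (coframe m) x).det := by
  rw [isUnit_iff_ne_zero]
  refine mt Matrix.exists_mulVec_eq_zero_iff.2 ?_
  rintro ⟨v, hv, hker⟩
  set X : E4 := WithLp.toLp 2 v
  have hθ (a : Fin 4) : coframe m a x X = 0 := by
    rw [apply_eq_sum_basisVec]
    refine Eq.trans ?_ (congrFun hker a)
    exact Finset.sum_congr rfl fun i _ => mul_comm _ _
  have hrad : radialDiff m x X = 0 := by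
    simpa [coframe_zero_apply, (one_add_pos hm x).ne'] using hθ 0
  have hang : angularDiff m x X = 0 := by
    simpa [coframe_three_apply, (R_pos hm hx).ne'] using hθ 3
  have hsum := sum_forms_eq hm x X X
  simp only [hθ, hrad, hang, ← pow_two, ← norm_z₁_sq, ← norm_z₂_sq] at hsum
  have hX0 : X = 0 := eq_zero_of_weighted_norm_eq_zero (m := m) (x := x) <| by
    simpa [(R_pos hm hx).ne', eq_comm] using hsum
  exact hv ((WithLp.toLp_eq_zero 2).1 hX0)

theorem diagonalizes_taubNUT {m : ℝ} (hm : 0 < m) :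
    Diagonalizes (coframe m) (diagCoeff m) (taubNUT m) {0}ᶜ where
  eq_sum _ hx := taubNUT_apply hm hx
  ne_zero _ hx a := (diagCoeff_pos hm hx a).ne'
  isUnit_det _ hx := isUnit_det_coframe hm hx

theorem det_taubNUT_ne_zero {m : ℝ} (hm : 0 < m) (x : E4) : (taubNUT m x).det ≠ 0 := by
  by_cases hx : x = 0
  · rw [taubNUT, if_pos hx, Matrix.det_one]
    exact one_ne_zero
  · exact (diagonalizes_taubNUT hm).det_ne_zero hx

theorem hasFDerivAt_P {m : ℝ} (hm : 0 < m) (x : E4) :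
    HasFDerivAt (P m) ((-(4 * m) * P m x) • coframe m 0 x) x := by
  refine ((hasFDerivAt_y_zero hm x).const_mul (4 * m)).fun_neg.exp.congr_fderiv ?_
  ext X
  simp only [smul_neg, _root_.neg_apply, _root_.smul_apply, smul_eq_mul, P]
  ring

theorem hasFDerivAt_Q {m : ℝ} (hm : 0 < m) (x : E4) :
    HasFDerivAt (Q m) ((4 * m * Q m x) • coframe m 0 x) x := by
  refine ((hasFDerivAt_y_zero hm x).const_mul (4 * m)).exp.congr_fderiv ?_
  rw [Q, smul_smul]
  ring_nf

theorem hasFDerivAt_R {m : ℝ} (hm : 0 < m) (x : E4) :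
    HasFDerivAt (R m) (radialSum m x - (4 * m * y m 0 x) • coframe m 0 x) x := by
  have hR : R m = fun z => (1 / 2) * (P m z * ‖z₁ z‖ ^ 2 + Q m z * ‖z₂ z‖ ^ 2) := by
    ext z
    rw [← two_mul_R hm]
    ring
  rw [hR]
  refine ((((hasFDerivAt_P hm x).mul (hasFDerivAt_norm_z₁_sq x)).add
    ((hasFDerivAt_Q hm x).mul (hasFDerivAt_norm_z₂_sq x))).const_mul (1 / 2)).congr_fderiv ?_
  refine ContinuousLinearMap.ext fun X => ?_
  simp only [_root_.sub_apply, _root_.add_apply, _root_.smul_apply, smul_eq_mul, radialSum_apply]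
  linear_combination 2 * m * coframe m 0 x X * two_mul_y_zero hm x

/-- The value `(β ∧ γ)(X, Y)`. -/
def wedge (β γ : E4 →L[ℝ] ℝ) (X Y : E4) : ℝ := β X * γ Y - β Y * γ X

theorem hasFDerivAt_angularDiff {m : ℝ} (hm : 0 < m) (x X : E4) :
    HasFDerivAt (fun z => angularDiff m z X)
      (P m x • (X 1 • dx 0 - X 0 • dx 1) - Q m x • (X 3 • dx 2 - X 2 • dx 3)
        - (4 * m * angularSum m x X) • coframe m 0 x) x := by
  have hcoord (i : Fin 4) (c : ℝ) := (hasFDerivAt_coord i x).mul_const c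
  refine (((hasFDerivAt_P hm x).mul ((hcoord 0 (X 1)).sub (hcoord 1 (X 0)))).sub
    ((hasFDerivAt_Q hm x).mul ((hcoord 2 (X 3)).sub (hcoord 3 (X 2))))).congr_fderiv ?_
  ext Y
  simp only [Pi.sub_apply, _root_.sub_apply, _root_.add_apply, _root_.smul_apply, PiLp.proj_apply,
    smul_eq_mul, angularSum_apply, rot₁_apply, rot₂_apply]
  ring

theorem hasFDerivAt_coframe_three {m : ℝ} (hm : 0 < m) {x : E4} (hx : x ≠ 0) (X : E4) :
    HasFDerivAt (fun z => coframe m 3 z X)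
      ((2 * R m x)⁻¹ • fderiv ℝ (fun z => angularDiff m z X) x
        - ((2 * R m x ^ 2)⁻¹ * angularDiff m x X) • fderiv ℝ (R m) x) x := by
  have hR := R_pos hm hx
  have hinv := (hasFDerivAt_inv (show 2 * R m x ≠ 0 by positivity)).comp x
    ((hasFDerivAt_R hm x).differentiableAt.hasFDerivAt.const_mul 2)
  refine (hinv.mul
    (hasFDerivAt_angularDiff hm x X).differentiableAt.hasFDerivAt).congr_fderiv ?_
  ext Y
  simp only [Function.comp_apply, ContinuousLinearMap.comp_smulₛₗ, Real.ringHom_apply,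
    _root_.add_apply, _root_.smul_apply, smul_eq_mul, ContinuousLinearMap.comp_apply,
    ContinuousLinearMap.toSpanSingleton_apply, _root_.sub_apply]
  field_simp
  ring

theorem R_mul_angularSum {m : ℝ} (hm : 0 < m) (x X : E4) :
    R m x * angularSum m x X = y m 0 x * angularDiff m x X
      + (y m 1 x * coframe m 2 x X - y m 2 x * coframe m 1 x X) := by
  have hR := two_mul_R hm x
  have hy := two_mul_y_zero hm x
  rw [norm_z₁_sq, norm_z₂_sq] at hR hy
  rw [y_one, y_two]
  simp only [angularSum_apply, angularDiff_apply, rot₁_apply, rot₂_apply, coframe_one_apply,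
    coframe_two_apply]
  linear_combination (1 / 2) * (P m x * (x 0 * X 1 - x 1 * X 0)
      + Q m x * (x 2 * X 3 - x 3 * X 2)) * hR
    - (1 / 2) * (P m x * (x 0 * X 1 - x 1 * X 0) - Q m x * (x 2 * X 3 - x 3 * X 2)) * hy
    + ((x 2 ^ 2 + x 3 ^ 2) * (x 0 * X 1 - x 1 * X 0)
      + (x 0 ^ 2 + x 1 ^ 2) * (x 2 * X 3 - x 3 * X 2)) * P_mul_Q m x

theorem wedge_radialSum_angularDiff {m : ℝ} (hm : 0 < m) (x X Y : E4) :
    R m x * wedge (radialSum m x) (angularDiff m x) X Y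
        + wedge (radialDiff m x) (y m 1 x • coframe m 2 x - y m 2 x • coframe m 1 x) X Y
      = 2 * R m x ^ 2 * (P m x * wedge (dx 0) (dx 1) X Y - Q m x * wedge (dx 2) (dx 3) X Y)
        + y m 0 x * wedge (coframe m 1 x) (coframe m 2 x) X Y := by
  have hR : R m x = (P m x * (x 0 ^ 2 + x 1 ^ 2) + Q m x * (x 2 ^ 2 + x 3 ^ 2)) / 2 := by
    linarith [norm_z₁_sq x ▸ norm_z₂_sq x ▸ two_mul_R hm x]
  have hy : y m 0 x = (P m x * (x 0 ^ 2 + x 1 ^ 2) - Q m x * (x 2 ^ 2 + x 3 ^ 2)) / 2 := by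
    linarith [norm_z₁_sq x ▸ norm_z₂_sq x ▸ two_mul_y_zero hm x]
  have hdx (i : Fin 4) (Z : E4) : dx i Z = Z i := rfl
  rw [hR, hy, y_one, y_two]
  simp only [wedge, _root_.sub_apply, _root_.smul_apply, smul_eq_mul, hdx, radialSum_apply,
    radialDiff_apply, angularDiff_apply, rad₁_apply, rad₂_apply, rot₁_apply, rot₂_apply,
    coframe_one_apply, coframe_two_apply]
  linear_combination (-1 / 2) * (P m x * (x 0 ^ 2 + x 1 ^ 2) + Q m x * (x 2 ^ 2 + x 3 ^ 2)) *
    ((x 2 ^ 2 + x 3 ^ 2) * (X 0 * Y 1 - X 1 * Y 0) - (x 0 ^ 2 + x 1 ^ 2) * (X 2 * Y 3 - X 3 * Y 2)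
    + ((x 0 * X 0 + x 1 * X 1) * (x 2 * Y 3 - x 3 * Y 2)
      - (x 0 * Y 0 + x 1 * Y 1) * (x 2 * X 3 - x 3 * X 2))
    - ((x 2 * X 2 + x 3 * X 3) * (x 0 * Y 1 - x 1 * Y 0)
      - (x 2 * Y 2 + x 3 * Y 3) * (x 0 * X 1 - x 1 * X 0))) * P_mul_Q m x

theorem extDeriv_coframe_three {m : ℝ} (hm : 0 < m) {x : E4} (hx : x ≠ 0) (X Y : E4) :
    fderiv ℝ (fun z => coframe m 3 z Y) x X - fderiv ℝ (fun z => coframe m 3 z X) x Y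
      = -(2 * R m x ^ 3)⁻¹ * (y m 0 x * wedge (coframe m 1 x) (coframe m 2 x) X Y
        + y m 1 x * wedge (coframe m 2 x) (coframe m 0 x) X Y
        + y m 2 x * wedge (coframe m 0 x) (coframe m 1 x) X Y) := by
  have hR := R_pos hm hx
  have hrad (Z : E4) : radialDiff m x Z = (1 + 4 * m * R m x) * coframe m 0 x Z :=
    (mul_inv_cancel_left₀ (one_add_pos hm x).ne' _).symm
  have hwedge := wedge_radialSum_angularDiff hm x X Y
  have hX := R_mul_angularSum hm x X
  have hY := R_mul_angularSum hm x Y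
  have hdx (i : Fin 4) (Z : E4) : dx i Z = Z i := rfl
  simp only [(hasFDerivAt_coframe_three hm hx _).fderiv, (hasFDerivAt_R hm x).fderiv,
    (hasFDerivAt_angularDiff hm x _).fderiv, wedge, _root_.sub_apply, _root_.smul_apply,
    smul_eq_mul, hdx, hrad] at hwedge ⊢
  field_simp
  linear_combination -hwedge
    + 4 * m * R m x * (coframe m 0 x Y * hX - coframe m 0 x X * hY)

theorem hasFDerivAt_coframe_castSucc {m : ℝ} (hm : 0 < m) (i : Fin 3) (x X : E4) :
    HasFDerivAt (fun z => coframe m i.castSucc z X)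
      ((ContinuousLinearMap.apply ℝ ℝ X).comp (fderiv ℝ (fderiv ℝ (y m i)) x)) x := by
  have hdy : (fun z => coframe m i.castSucc z X) = fun z => fderiv ℝ (y m i) z X := by
    ext z
    rw [(hasFDerivAt_y hm i z).fderiv]
  have hdiff : DifferentiableAt ℝ (fderiv ℝ (y m i)) x :=
    ((contDiff_y hm i).fderiv_right (m := ∞) le_rfl).differentiable (by simp) x
  rw [hdy]
  exact (ContinuousLinearMap.apply ℝ ℝ X).hasFDerivAt.comp x hdiff.hasFDerivAt

theorem extDeriv_coframe_castSucc {m : ℝ} (hm : 0 < m) (i : Fin 3) (x X Y : E4) :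
    fderiv ℝ (fun z => coframe m i.castSucc z Y) x X
      - fderiv ℝ (fun z => coframe m i.castSucc z X) x Y = 0 := by
  have hsymm : IsSymmSndFDerivAt ℝ (y m i) x := (contDiff_y hm i).contDiffAt.isSymmSndFDerivAt
    (by rw [minSmoothness_of_isRCLikeNormedField]; exact WithTop.coe_le_coe.2 le_top)
  rw [(hasFDerivAt_coframe_castSucc hm i x X).fderiv,
    (hasFDerivAt_coframe_castSucc hm i x Y).fderiv]
  exact sub_eq_zero.2 (hsymm X Y)

/-- The antisymmetric components of `y₁ dy₂∧dy₃ + y₂ dy₃∧dy₁ + y₃ dy₁∧dy₂` in the coframe. -/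
def areaCoeff (m : ℝ) : Fin 4 → Fin 4 → E4 → ℝ :=
  ![![0, y m 2, -y m 1, 0], ![-y m 2, 0, y m 0, 0], ![y m 1, -y m 0, 0, 0], ![0, 0, 0, 0]]

/-- The structure coefficients of the coframe, for which
`dη = -(2R³)⁻¹ (y₁ dy₂∧dy₃ + y₂ dy₃∧dy₁ + y₃ dy₁∧dy₂)`. -/
def structureCoeff (m : ℝ) (c a b : Fin 4) (x : E4) : ℝ :=
  if c = 3 then -(2 * R m x ^ 3)⁻¹ * areaCoeff m a b x else 0

theorem sum_areaCoeff_mul (m : ℝ) (x : E4) (s t : Fin 4 → ℝ) :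
    ∑ a, ∑ b, areaCoeff m a b x * (s a * t b) = y m 0 x * (s 1 * t 2 - t 1 * s 2)
      + y m 1 x * (s 2 * t 0 - t 2 * s 0) + y m 2 x * (s 0 * t 1 - t 0 * s 1) := by
  simp only [areaCoeff, cons_val', cons_val_fin_one, Pi.zero_apply, Pi.neg_apply, Fin.sum_univ_four,
    cons_val_zero, cons_val_one, cons_val]
  ring

theorem structureCoeff_antisymm (m : ℝ) (c a b : Fin 4) (x : E4) :
    structureCoeff m c b a x = -structureCoeff m c a b x := by
  have harea : areaCoeff m b a x = -areaCoeff m a b x := by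
    fin_cases a <;> fin_cases b <;> simp [areaCoeff]
  by_cases hc : c = 3 <;> simp [structureCoeff, hc, harea]

theorem hasStructureCoeffs_coframe {m : ℝ} (hm : 0 < m) :
    HasStructureCoeffs (coframe m) (structureCoeff m) {0}ᶜ where
  differentiableAt x hx c i := by
    induction c using Fin.lastCases with
    | last => exact (hasFDerivAt_coframe_three hm hx _).differentiableAt
    | cast c => exact (hasFDerivAt_coframe_castSucc hm c x _).differentiableAt
  antisymm x _ c a b := structureCoeff_antisymm m c a b x
  extDeriv x hx c i j := by
    induction c using Fin.lastCases with
    | last =>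
      simp only [structureCoeff, Fin.reduceLast, if_true, mul_assoc, ← Finset.mul_sum,
        sum_areaCoeff_mul]
      exact extDeriv_coframe_three hm hx (basisVec i) (basisVec j)
    | cast c =>
      have hc : c.castSucc ≠ 3 := (Fin.castSucc_lt_last c).ne
      simp only [structureCoeff, hc, if_false, zero_mul, Finset.sum_const_zero]
      exact extDeriv_coframe_castSucc hm c x (basisVec i) (basisVec j)

/-- The region `R > ρ`, a neighbourhood of infinity. -/
def region (m ρ : ℝ) : Set E4 := {x | ρ < R m x}

theorem isOpen_region {m : ℝ} (hm : 0 < m) (ρ : ℝ) : IsOpen (region m ρ) :=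
  isOpen_lt continuous_const (contDiff_R hm).continuous

theorem isCompact_compl_region {m : ℝ} (hm : 0 < m) (ρ : ℝ) : IsCompact (region m ρ)ᶜ := by
  refine (isCompact_closedBall 0 (Real.sqrt (2 * ρ * Real.exp (4 * m * ρ)))).of_isClosed_subset
    (isOpen_region hm ρ).isClosed_compl fun x hx => ?_
  have hx : R m x ≤ ρ := not_lt.1 hx
  have hy := abs_le.1 (abs_y_le hm 0 x)
  have hP : 1 ≤ P m x * Real.exp (4 * m * ρ) := by
    rw [P, ← Real.exp_add]
    exact Real.one_le_exp (by nlinarith)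
  have hQ : 1 ≤ Q m x * Real.exp (4 * m * ρ) := by
    rw [Q, ← Real.exp_add]
    exact Real.one_le_exp (by nlinarith)
  rw [mem_closedBall_zero_iff]
  refine Real.le_sqrt_of_sq_le ?_
  calc ‖x‖ ^ 2 = ‖z₁ x‖ ^ 2 + ‖z₂ x‖ ^ 2 := norm_sq_eq x
    _ ≤ P m x * Real.exp (4 * m * ρ) * ‖z₁ x‖ ^ 2 + Q m x * Real.exp (4 * m * ρ) * ‖z₂ x‖ ^ 2 :=
        add_le_add (le_mul_of_one_le_left (sq_nonneg _) hP)
          (le_mul_of_one_le_left (sq_nonneg _) hQ)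
    _ = 2 * R m x * Real.exp (4 * m * ρ) := by rw [two_mul_R hm]; ring
    _ ≤ 2 * ρ * Real.exp (4 * m * ρ) := by gcongr

/-! ### Functions of a given order at infinity -/

section Order

variable {m ρ : ℝ} {k l j : ℤ} {n : ℕ} {F G : E4 → ℝ}

theorem ne_zero_of_R_pos (hm : 0 < m) {x : E4} (hx : 0 < R m x) : x ≠ 0 := by
  rintro rfl
  have hR : 2 * R m 0 = P m 0 * ‖(0 : ℂ)‖ ^ 2 + Q m 0 * ‖(0 : ℂ)‖ ^ 2 := two_mul_R hm 0
  simp only [norm_zero] at hR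
  linarith

theorem region_subset (hm : 0 < m) (hρ : 1 ≤ ρ) : region m ρ ⊆ {0}ᶜ :=
  fun _ hx => ne_zero_of_R_pos hm (zero_lt_one.trans_le hρ |>.trans hx)

/-- The function `F` is a symbol of weight `Rᵏ` on the region `R > ρ`: its derivatives of order at
most `n` along the coframe are all `O(Rᵏ)`. No decay is gained by differentiating. -/
abbrev HasOrder (m ρ : ℝ) (k : ℤ) (n : ℕ) (F : E4 → ℝ) : Prop :=
  IsSymbol (coframe m) (region m ρ) (fun x => R m x ^ k) n F

theorem hasOrder_zero_iff :
    HasOrder m ρ 0 n F ↔ IsSymbol (coframe m) (region m ρ) 1 n F := by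
  simp only [HasOrder, zpow_zero]
  rfl

theorem isBigO_zpow_of_le (hρ : 1 ≤ ρ) (hkl : k ≤ l) :
    (fun x => R m x ^ k) =O[𝓟 (region m ρ)] fun x => R m x ^ l := by
  refine IsBigO.of_bound 1 (eventually_principal.2 fun x hx => ?_)
  have hR : 1 ≤ R m x := hρ.trans hx.le
  rw [one_mul, Real.norm_of_nonneg (by positivity), Real.norm_of_nonneg (by positivity)]
  exact zpow_le_zpow_right₀ hR hkl

namespace HasOrder

theorem mono (hρ : 1 ≤ ρ) (hF : HasOrder m ρ k n F) (hkl : k ≤ l) : HasOrder m ρ l n F :=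
  hF.weight_mono (isBigO_zpow_of_le hρ hkl)

theorem mul (hρ : 1 ≤ ρ) (hF : HasOrder m ρ k n F) (hG : HasOrder m ρ l n G) (hkl : k + l ≤ j) :
    HasOrder m ρ j n fun x => F x * G x := by
  refine (IsSymbol.mul hF hG).weight_mono (IsBigO.trans (.of_bound 1 ?_) (isBigO_zpow_of_le hρ hkl))
  refine eventually_principal.2 fun x (hx : ρ < R m x) => ?_
  rw [Pi.mul_apply, ← zpow_add₀ (by linarith), one_mul]

theorem const (c : ℝ) : HasOrder m ρ 0 n fun _ => c := hasOrder_zero_iff.2 (.const c)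

theorem inv (hρ : 1 ≤ ρ) {c : ℝ} (hc : 0 < c) (hcF : ∀ x ∈ region m ρ, c * R m x ^ k ≤ F x)
    (hF : HasOrder m ρ k n F) : HasOrder m ρ (-k) n fun x => (F x)⁻¹ := by
  have hR {x : E4} (hx : x ∈ region m ρ) : 0 < R m x := by linarith [show ρ < R m x from hx]
  have hwF : (fun x => R m x ^ k) =O[𝓟 (region m ρ)] F := by
    refine .of_bound c⁻¹ (eventually_principal.2 fun x hx => ?_)
    rw [Real.norm_of_nonneg (zpow_nonneg (hR hx).le _), ← div_eq_inv_mul, le_div_iff₀' hc]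
    exact (hcF x hx).trans (le_abs_self _)
  simp only [HasOrder, _root_.zpow_neg]
  exact IsSymbol.inv (fun x hx => (zpow_pos (hR hx) k).ne') hwF hF

end HasOrder

theorem hasOrder_y (hm : 0 < m) (hρ : 1 ≤ ρ) (i : Fin 3) : HasOrder m ρ 1 n (y m i) := by
  have hy : y m i =O[𝓟 (region m ρ)] fun x => R m x ^ (1 : ℤ) :=
    .of_bound 1 (.of_forall fun x => by
      simpa [abs_of_nonneg (R_nonneg m x)] using abs_y_le hm i x)
  cases n with
  | zero => exact hy
  | succ n =>
    refine ⟨hy, fun a _ => if a = i.castSucc then 1 else 0, fun x _ => ?_, fun a => ?_⟩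
    · simpa using hasFDerivAt_y hm i x
    · exact (HasOrder.const _).mono hρ zero_le_one

/-- The components of `dR` in the coframe. -/
def gradR (m : ℝ) : Fin 4 → E4 → ℝ :=
  ![fun x => y m 0 x * (R m x)⁻¹, fun x => y m 1 x * (R m x)⁻¹, fun x => y m 2 x * (R m x)⁻¹,
    fun _ => 0]

theorem hasFDerivAt_R_gradR (hm : 0 < m) {x : E4} (hx : x ≠ 0) :
    HasFDerivAt (R m) (∑ a, gradR m a x • coframe m a x) x := by
  have hdR := (hasFDerivAt_R hm x).differentiableAt.hasFDerivAt
  have hdR_sq := (hdR.pow 2).unique <|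
    ((((hasFDerivAt_y hm 0 x).pow 2).add ((hasFDerivAt_y hm 1 x).pow 2)).add
      ((hasFDerivAt_y hm 2 x).pow 2)).congr_of_eventuallyEq (.of_forall fun z => R_sq hm z)
  refine hdR.congr_fderiv (ContinuousLinearMap.ext fun X => ?_)
  have hX := congrArg (fun l : E4 →L[ℝ] ℝ => l X) hdR_sq
  have hR := R_pos hm hx
  simp only [Nat.add_one_sub_one, pow_one, nsmul_eq_mul, Nat.cast_ofNat, _root_.smul_apply,
    smul_eq_mul, Fin.castSucc_zero, Fin.castSucc_one, Fin.reduceCastSucc,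
    _root_.add_apply] at hX
  simp only [gradR, Fin.sum_univ_four, cons_val_zero, cons_val_one, cons_val,
    zero_smul, add_zero, _root_.add_apply, _root_.smul_apply, smul_eq_mul]
  field_simp
  linear_combination (1 / 2) * hX

theorem hasOrder_R (hm : 0 < m) (hρ : 1 ≤ ρ) : HasOrder m ρ 1 n (R m) := by
  have hR : R m =O[𝓟 (region m ρ)] fun x => R m x ^ (1 : ℤ) := by
    simpa only [zpow_one] using isBigO_refl _ _
  induction n with
  | zero => exact hR
  | succ n ih =>
    have hinv : HasOrder m ρ (-1) n fun x => (R m x)⁻¹ :=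
      HasOrder.inv hρ one_pos (fun x _ => by rw [one_mul, zpow_one]) ih
    have hy_mul_inv (i : Fin 3) : HasOrder m ρ 1 n fun x => y m i x * (R m x)⁻¹ :=
      (hasOrder_y hm hρ i).mul hρ hinv (by norm_num)
    refine ⟨hR, gradR m, fun x hx => hasFDerivAt_R_gradR hm (region_subset hm hρ hx), fun a => ?_⟩
    fin_cases a
    exacts [hy_mul_inv 0, hy_mul_inv 1, hy_mul_inv 2, IsSymbol.zero]

theorem hasOrder_R_inv (hm : 0 < m) (hρ : 1 ≤ ρ) : HasOrder m ρ (-1) n fun x => (R m x)⁻¹ :=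
  HasOrder.inv hρ one_pos (fun x _ => by rw [one_mul, zpow_one]) (hasOrder_R hm hρ)

theorem hasOrder_gradR (hm : 0 < m) (hρ : 1 ≤ ρ) (a : Fin 4) : HasOrder m ρ 0 n (gradR m a) := by
  have hy_mul_inv (i : Fin 3) : HasOrder m ρ 0 n fun x => y m i x * (R m x)⁻¹ :=
    (hasOrder_y hm hρ i).mul hρ (hasOrder_R_inv hm hρ) (by norm_num)
  fin_cases a
  exacts [hy_mul_inv 0, hy_mul_inv 1, hy_mul_inv 2, IsSymbol.zero]

theorem hasOrder_V (hm : 0 < m) (hρ : 1 ≤ ρ) : HasOrder m ρ 0 n (V m) := by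
  have h : HasOrder m ρ 0 n fun x => 2 * m + 2⁻¹ * (R m x)⁻¹ :=
    (HasOrder.const _).add (IsSymbol.const_mul _ ((hasOrder_R_inv hm hρ).mono hρ (by norm_num)))
  refine IsSymbol.congr (isOpen_region hm ρ) h fun x hx => ?_
  simp only [V_eq hm (region_subset hm hρ hx), mul_inv]

theorem two_mul_le_V (hm : 0 < m) {x : E4} (hx : x ≠ 0) : 2 * m ≤ V m x := by
  have hR := R_pos hm hx
  rw [V_eq hm hx, le_add_iff_nonneg_right]
  positivity

theorem hasOrder_V_inv (hm : 0 < m) (hρ : 1 ≤ ρ) : HasOrder m ρ 0 n fun x => (V m x)⁻¹ :=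
  HasOrder.inv (c := 2 * m) (k := 0) hρ (by positivity) (fun x hx => by
    simpa only [zpow_zero, mul_one] using two_mul_le_V hm (region_subset hm hρ hx))
    (hasOrder_V hm hρ)

theorem hasOrder_diagCoeff (hm : 0 < m) (hρ : 1 ≤ ρ) (a : Fin 4) :
    HasOrder m ρ 0 n (diagCoeff m a) := by
  fin_cases a
  exacts [hasOrder_V hm hρ, hasOrder_V hm hρ, hasOrder_V hm hρ, hasOrder_V_inv hm hρ]

theorem hasOrder_diagCoeff_inv (hm : 0 < m) (hρ : 1 ≤ ρ) (a : Fin 4) :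
    HasOrder m ρ 0 n fun x => (diagCoeff m a x)⁻¹ := by
  have hV_inv : HasOrder m ρ 0 n fun x => (V m x)⁻¹ := hasOrder_V_inv hm hρ
  fin_cases a
  exacts [hV_inv, hV_inv, hV_inv, by simpa [diagCoeff] using hasOrder_V hm hρ]

/-- The components of `dV = -(2R²)⁻¹ dR` in the coframe. -/
def gradV (m : ℝ) (b : Fin 4) (x : E4) : ℝ := -(2⁻¹ * ((R m x)⁻¹ * ((R m x)⁻¹ * gradR m b x)))

/-- The components of the differentials of the diagonal coefficients of the metric. -/
def gradDiagCoeff (m : ℝ) : Fin 4 → Fin 4 → E4 → ℝ :=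
  ![gradV m, gradV m, gradV m, fun b x => -((V m x)⁻¹ * ((V m x)⁻¹ * gradV m b x))]

theorem hasFDerivAt_V (hm : 0 < m) {x : E4} (hx : x ≠ 0) :
    HasFDerivAt (V m) (∑ b, gradV m b x • coframe m b x) x := by
  have hR := (R_pos hm hx).ne'
  have hV : V m =ᶠ[𝓝 x] fun z => 2 * m + 2⁻¹ * (R m z)⁻¹ :=
    (isOpen_compl_singleton.eventually_mem hx).mono fun z hz => by rw [V_eq hm hz, mul_inv]
  refine HasFDerivAt.congr_of_eventuallyEq ?_ hV
  refine ((((hasDerivAt_inv hR).comp_hasFDerivAt x (hasFDerivAt_R_gradR hm hx)).const_mul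
    (2⁻¹ : ℝ)).const_add (2 * m)).congr_fderiv ?_
  simp only [gradV, Finset.smul_sum, smul_smul]
  refine Finset.sum_congr rfl fun b _ => ?_
  congr 1
  field_simp

theorem hasFDerivAt_diagCoeff (hm : 0 < m) {x : E4} (hx : x ≠ 0) (a : Fin 4) :
    HasFDerivAt (diagCoeff m a) (∑ b, gradDiagCoeff m a b x • coframe m b x) x := by
  have hV := hasFDerivAt_V hm hx
  have hV_inv : HasFDerivAt (fun z => (V m z)⁻¹)
      (∑ b, -((V m x)⁻¹ * ((V m x)⁻¹ * gradV m b x)) • coframe m b x) x := by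
    refine ((hasDerivAt_inv (V_pos hm hx).ne').comp_hasFDerivAt x hV).congr_fderiv ?_
    simp only [Finset.smul_sum, smul_smul]
    refine Finset.sum_congr rfl fun b _ => ?_
    congr 1
    field_simp
  fin_cases a
  exacts [hV, hV, hV, hV_inv]

theorem hasOrder_gradDiagCoeff (hm : 0 < m) (hρ : 1 ≤ ρ) (a b : Fin 4) :
    HasOrder m ρ 0 n (gradDiagCoeff m a b) := by
  have hR : HasOrder m ρ (-1) n fun x => (R m x)⁻¹ := hasOrder_R_inv hm hρ
  have hV : HasOrder m ρ 0 n (gradV m b) :=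
    (IsSymbol.const_mul _ (hR.mul hρ (hR.mul hρ (hasOrder_gradR hm hρ b) le_rfl)
      (by norm_num))).neg
  have hV_inv := hasOrder_V_inv (n := n) hm hρ
  fin_cases a
  exacts [hV, hV, hV, (hV_inv.mul hρ (hV_inv.mul hρ hV le_rfl) le_rfl).neg]

theorem hasOrder_areaCoeff (hm : 0 < m) (hρ : 1 ≤ ρ) (a b : Fin 4) :
    HasOrder m ρ 1 n (areaCoeff m a b) := by
  have hy (i : Fin 3) : HasOrder m ρ 1 n (y m i) := hasOrder_y hm hρ i
  have h0 : HasOrder m ρ 1 n 0 := IsSymbol.zero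
  fin_cases a <;> fin_cases b
  exacts [h0, hy 2, (hy 1).neg, h0, (hy 2).neg, h0, hy 0, h0, hy 1, (hy 0).neg, h0, h0, h0, h0, h0,
    h0]

theorem hasOrder_structureCoeff (hm : 0 < m) (hρ : 1 ≤ ρ) (c a b : Fin 4) :
    HasOrder m ρ 0 n (structureCoeff m c a b) := by
  by_cases hc : c = 3
  · have hR : HasOrder m ρ (-1) n fun x => (R m x)⁻¹ := hasOrder_R_inv hm hρ
    have h : HasOrder m ρ 0 n fun x =>
        -2⁻¹ * ((R m x)⁻¹ * ((R m x)⁻¹ * ((R m x)⁻¹ * areaCoeff m a b x))) :=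
      IsSymbol.const_mul _ (hR.mul hρ (hR.mul hρ (hR.mul hρ (hasOrder_areaCoeff hm hρ a b)
        le_rfl) le_rfl) (by norm_num))
    convert h using 2 with x
    rw [structureCoeff, if_pos hc, mul_inv]
    ring
  · have h0 : structureCoeff m c a b = fun _ => 0 := funext fun x => by
      rw [structureCoeff, if_neg hc]
    exact h0 ▸ IsSymbol.zero

/-- The coefficients of the Levi-Civita connection of the Taub-NUT metric in the coframe. -/
def connectionCoeff (m : ℝ) (c a b : Fin 4) (x : E4) : ℝ :=
  connCoeff (fun c => diagCoeff m c x) (fun c b => gradDiagCoeff m c b x)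
    (fun c a b => structureCoeff m c a b x) c a b

theorem hasConnectionCoeffs_taubNUT (hm : 0 < m) :
    HasConnectionCoeffs (taubNUT m) (coframe m) (connectionCoeff m) {0}ᶜ :=
  hasConnectionCoeffs_connCoeff isOpen_compl_singleton (diagonalizes_taubNUT hm)
    (hasStructureCoeffs_coframe hm) fun _ hx => hasFDerivAt_diagCoeff hm hx

theorem hasOrder_connectionCoeff (hm : 0 < m) (hρ : 1 ≤ ρ) (c a b : Fin 4) :
    HasOrder m ρ 0 n (connectionCoeff m c a b) := by
  have hgrad (p : Prop) [Decidable p] (a b : Fin 4) :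
      HasOrder m ρ 0 n fun x => if p then gradDiagCoeff m a b x else 0 := by
    split_ifs
    exacts [hasOrder_gradDiagCoeff hm hρ a b, IsSymbol.zero]
  have hdτ (c c' a b : Fin 4) :
      HasOrder m ρ 0 n fun x => diagCoeff m c x * structureCoeff m c' a b x :=
    (hasOrder_diagCoeff hm hρ c).mul hρ (hasOrder_structureCoeff hm hρ c' a b) le_rfl
  have hd_inv : HasOrder m ρ 0 n fun x => (2 * diagCoeff m c x)⁻¹ := by
    simpa only [mul_inv] using IsSymbol.const_mul 2⁻¹ (hasOrder_diagCoeff_inv hm hρ c)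
  refine hd_inv.mul (l := 0) hρ ?_ le_rfl
  exact (((((hgrad _ c a).add (hgrad _ c b)).sub (hgrad _ a c)).sub (hdτ c c a b)).add
    (hdτ b b a c)).add (hdτ a a b c)

theorem HasComponents.tensorNorm_iterCovDeriv_isBigO (hm : 0 < m) (hρ : 1 ≤ ρ) {r : ℕ}
    {T : TensorField r} {t : (Fin r → Fin 4) → E4 → ℝ}
    (hT : HasComponents (coframe m) (region m ρ) T t) {ℓ : ℕ}
    (ht : ∀ A, HasOrder m ρ k ℓ (t A)) :
    tensorNorm (taubNUT m) (iterCovDeriv (taubNUT m) T ℓ)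
      =O[𝓟 (region m ρ)] fun x => R m x ^ k := by
  have hsub := region_subset hm hρ
  obtain ⟨t', hT', ht'⟩ := hT.exists_iterCovDeriv_isSymbol (isOpen_region hm ρ)
    ((hasStructureCoeffs_coframe hm).mono hsub)
    (fun x hx => hasConnectionCoeffs_taubNUT hm x (hsub hx))
    (fun n c a b => hasOrder_zero_iff.1 (hasOrder_connectionCoeff hm hρ c a b)) ℓ 0
    (by rwa [zero_add])
  exact hT'.tensorNorm_isBigO ((diagonalizes_taubNUT hm).mono hsub)
    (fun a => (hasOrder_zero_iff.1 (hasOrder_diagCoeff_inv (n := 0) hm hρ a)).isBigO)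
    fun A => (ht' A).isBigO

theorem exists_bound_of_continuous (hm : 0 < m) (hF : Continuous F)
    (hF_isBigO : F =O[𝓟 (region m ρ)] fun x => R m x ^ (-1 : ℤ)) :
    ∃ C : ℝ, ∀ x : E4, x ≠ 0 → |F x| ≤ C * (R m x)⁻¹ := by
  obtain ⟨C₁, hC₁⟩ := isBigO_principal.1 hF_isBigO
  obtain ⟨C₂, hC₂⟩ := (isCompact_compl_region hm ρ).exists_bound_of_continuousOn hF.continuousOn
  refine ⟨max C₁ (C₂ * ρ), fun x hx => ?_⟩
  have hR := R_pos hm hx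
  rcases lt_or_ge ρ (R m x) with hρx | hρx
  · calc |F x| ≤ C₁ * ‖R m x ^ (-1 : ℤ)‖ := hC₁ x hρx
      _ = C₁ * (R m x)⁻¹ := by rw [_root_.zpow_neg_one, Real.norm_of_nonneg (by positivity)]
      _ ≤ max C₁ (C₂ * ρ) * (R m x)⁻¹ := by gcongr; exact le_max_left _ _
  · have hC₂x := hC₂ x hρx.not_gt
    have hC₂_nonneg : 0 ≤ C₂ := (norm_nonneg _).trans hC₂x
    calc |F x| ≤ C₂ * R m x * (R m x)⁻¹ := by rwa [mul_inv_cancel_right₀ hR.ne']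
      _ ≤ C₂ * ρ * (R m x)⁻¹ := by gcongr
      _ ≤ max C₁ (C₂ * ρ) * (R m x)⁻¹ := by gcongr; exact le_max_right _ _

end Order

/-! ### Dilations -/

section Dilation

variable {m : ℝ} {s : E4 → ℝ}

/-- The map `x ↦ s x • x`; the map `ℶ` is the case `s = 1 + a / (κ + r⁴)`. -/
def dilation (s : E4 → ℝ) (x : E4) : E4 := s x • x

/-- The displacement `y₁ ∘ φ - y₁` of the first coordinate under the dilation `φ` with factor
`s`. -/
def shift (m : ℝ) (s : E4 → ℝ) (x : E4) : ℝ := y m 0 (dilation s x) - y m 0 x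

theorem dilation_apply (s : E4 → ℝ) (x : E4) (i : Fin 4) : dilation s x i = s x * x i := rfl

theorem norm_z₁_dilation_sq (s : E4 → ℝ) (x : E4) :
    ‖z₁ (dilation s x)‖ ^ 2 = s x ^ 2 * ‖z₁ x‖ ^ 2 := by
  simp only [norm_z₁_sq, dilation_apply]
  ring

theorem norm_z₂_dilation_sq (s : E4 → ℝ) (x : E4) :
    ‖z₂ (dilation s x)‖ ^ 2 = s x ^ 2 * ‖z₂ x‖ ^ 2 := by
  simp only [norm_z₂_sq, dilation_apply]
  ring

theorem y_one_dilation (m : ℝ) (s : E4 → ℝ) (x : E4) :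
    y m 1 (dilation s x) = s x ^ 2 * y m 1 x := by
  simp only [y_one, dilation_apply]
  ring

theorem y_two_dilation (m : ℝ) (s : E4 → ℝ) (x : E4) :
    y m 2 (dilation s x) = s x ^ 2 * y m 2 x := by
  simp only [y_two, dilation_apply]
  ring

theorem P_dilation (m : ℝ) (s : E4 → ℝ) (x : E4) :
    P m (dilation s x) = P m x * Real.exp (-(4 * m * shift m s x)) := by
  rw [P, P, ← Real.exp_add, shift]
  ring_nf

theorem Q_dilation (m : ℝ) (s : E4 → ℝ) (x : E4) :
    Q m (dilation s x) = Q m x * Real.exp (4 * m * shift m s x) := by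
  rw [Q, Q, ← Real.exp_add, shift]
  ring_nf

theorem P_mul_norm_sq (hm : 0 < m) (x : E4) : P m x * ‖z₁ x‖ ^ 2 = R m x + y m 0 x := by
  linarith [two_mul_R hm x, two_mul_y_zero hm x]

theorem Q_mul_norm_sq (hm : 0 < m) (x : E4) : Q m x * ‖z₂ x‖ ^ 2 = R m x - y m 0 x := by
  linarith [two_mul_R hm x, two_mul_y_zero hm x]

theorem two_mul_y_zero_dilation (hm : 0 < m) (x : E4) :
    2 * y m 0 (dilation s x) = s x ^ 2 *
      (Real.exp (-(4 * m * shift m s x)) * (R m x + y m 0 x)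
        - Real.exp (4 * m * shift m s x) * (R m x - y m 0 x)) := by
  rw [two_mul_y_zero hm, P_dilation, Q_dilation, norm_z₁_dilation_sq, norm_z₂_dilation_sq,
    ← P_mul_norm_sq hm, ← Q_mul_norm_sq hm]
  ring

theorem two_mul_R_dilation (hm : 0 < m) (x : E4) :
    2 * R m (dilation s x) = s x ^ 2 *
      (Real.exp (-(4 * m * shift m s x)) * (R m x + y m 0 x)
        + Real.exp (4 * m * shift m s x) * (R m x - y m 0 x)) := by
  rw [two_mul_R hm, P_dilation, Q_dilation, norm_z₁_dilation_sq, norm_z₂_dilation_sq,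
    ← P_mul_norm_sq hm, ← Q_mul_norm_sq hm]
  ring

/-- Both weights in the implicit equation for `y₁ ∘ φ` move it back towards `y₁`, so they only help
when that equation is multiplied by the displacement `δ`: this gives `δ² ≤ (s² - 1) y₁ δ`. -/
theorem abs_shift_le (hm : 0 < m) (x : E4) : |shift m s x| ≤ |s x ^ 2 - 1| * |y m 0 x| := by
  have hy := abs_le.1 (abs_y_le hm 0 x)
  have heq := two_mul_y_zero_dilation (s := s) hm x
  rw [← sub_add_cancel (y m 0 (dilation s x)) (y m 0 x), ← shift] at heq
  set δ := shift m s x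
  have hexp (t : ℝ) : 0 ≤ t * (Real.exp (4 * m * t) - 1) := by
    rcases le_total 0 t with ht | ht
    · exact mul_nonneg ht (sub_nonneg.2 (Real.one_le_exp (by positivity)))
    · refine mul_nonneg_of_nonpos_of_nonpos ht (sub_nonpos.2 (Real.exp_le_one_iff.2 ?_))
      exact mul_nonpos_of_nonneg_of_nonpos (by positivity) ht
  have hP : 0 ≤ δ * (1 - Real.exp (-(4 * m * δ))) := by
    have h := hexp (-δ)
    rw [mul_neg] at h
    linarith
  have hδ : δ ^ 2 ≤ (s x ^ 2 - 1) * y m 0 x * δ := by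
    have hsum : 0 ≤ s x ^ 2 * (δ * (1 - Real.exp (-(4 * m * δ))) * (R m x + y m 0 x)
        + δ * (Real.exp (4 * m * δ) - 1) * (R m x - y m 0 x)) :=
      mul_nonneg (sq_nonneg _) (add_nonneg (mul_nonneg hP (by linarith))
        (mul_nonneg (hexp δ) (by linarith)))
    linear_combination (1 / 2) * hsum + (1 / 2) * δ * heq
  rcases (abs_nonneg δ).eq_or_lt with hδ₀ | hδ₀
  · rw [← hδ₀]
    positivity
  · refine le_of_mul_le_mul_right ?_ hδ₀
    calc |δ| * |δ| = δ ^ 2 := by rw [abs_mul_abs_self, sq]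
      _ ≤ |(s x ^ 2 - 1) * y m 0 x * δ| := hδ.trans (le_abs_self _)
      _ = |s x ^ 2 - 1| * |y m 0 x| * |δ| := by rw [abs_mul, abs_mul]

theorem abs_y_dilation_sub_le (hm : 0 < m) (i : Fin 3) (x : E4) :
    |y m i (dilation s x) - y m i x| ≤ |s x ^ 2 - 1| * |y m i x| := by
  fin_cases i
  · exact abs_shift_le hm x
  · refine (congrArg abs ?_).trans_le (abs_mul (s x ^ 2 - 1) (y m 1 x)).le
    rw [sub_one_mul, ← y_one_dilation]
    rfl
  · refine (congrArg abs ?_).trans_le (abs_mul (s x ^ 2 - 1) (y m 2 x)).le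
    rw [sub_one_mul, ← y_two_dilation]
    rfl

theorem norm_y (hm : 0 < m) (x : E4) : ‖WithLp.toLp 2 fun i => y m i x‖ = R m x := by
  rw [EuclideanSpace.norm_eq, Fin.sum_univ_three]
  simp only [Real.norm_eq_abs, sq_abs]
  rw [← R_sq hm, Real.sqrt_sq (R_nonneg m x)]

theorem abs_R_dilation_sub_le (hm : 0 < m) (x : E4) :
    |R m (dilation s x) - R m x| ≤ |s x ^ 2 - 1| * R m x := by
  rw [← norm_y hm, ← norm_y hm]
  refine (abs_norm_sub_norm_le _ _).trans ?_
  rw [← WithLp.toLp_sub, ← Real.norm_eq_abs, ← norm_smul, ← WithLp.toLp_smul]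
  simp only [EuclideanSpace.norm_eq]
  refine Real.sqrt_le_sqrt (Finset.sum_le_sum fun i _ => ?_)
  gcongr
  simpa [abs_mul] using abs_y_dilation_sub_le (s := s) hm i x

theorem contDiff_dilation (hs : ContDiff ℝ ∞ s) : ContDiff ℝ ∞ (dilation s) := hs.smul contDiff_id

theorem fderiv_dilation_apply {x : E4} (hs : DifferentiableAt ℝ s x) (X : E4) (i : Fin 4) :
    fderiv ℝ (dilation s) x X i = s x * X i + fderiv ℝ s x X * x i := by
  have h : HasFDerivAt (dilation s) _ x := hs.hasFDerivAt.smul (hasFDerivAt_id x)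
  rw [h.fderiv]
  simp

theorem differentiableAt_shift (hm : 0 < m) {x : E4} (hs : DifferentiableAt ℝ s x) :
    DifferentiableAt ℝ (shift m s) x := by
  have hy : Differentiable ℝ (y m 0) := (contDiff_y hm 0).differentiable (by simp)
  exact ((hy _).comp x (hs.smul differentiableAt_id)).sub (hy x)

/-- Implicit differentiation of `two_mul_y_zero_dilation`. -/
theorem hasFDerivAt_shift (hm : 0 < m) {x : E4} (hs : DifferentiableAt ℝ s x) {R' μ' : E4 →L[ℝ] ℝ}
    (hR : HasFDerivAt (R m) R' x) (hμ : HasFDerivAt (fun x => s x ^ 2 - 1) μ' x) :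
    HasFDerivAt (shift m s)
      ((2 + 8 * m * R m (dilation s x))⁻¹ •
        ((Real.exp (-(4 * m * shift m s x)) * (R m x + y m 0 x)
            - Real.exp (4 * m * shift m s x) * (R m x - y m 0 x)) • μ'
          + (s x ^ 2 * (Real.exp (-(4 * m * shift m s x)) - Real.exp (4 * m * shift m s x))) • R'
          + (s x ^ 2 * (Real.exp (-(4 * m * shift m s x)) + Real.exp (4 * m * shift m s x)) - 2) •
            coframe m 0 x)) x := by
  have hδ := (differentiableAt_shift hm hs).hasFDerivAt
  have hy := hasFDerivAt_y_zero hm x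
  have hexp := hδ.const_mul (4 * m)
  have hlhs := (hδ.add hy).const_mul 2
  have hrhs := (hμ.add_const 1).mul
    ((hexp.neg.exp.mul (hR.add hy)).sub (hexp.exp.mul (hR.sub hy)))
  have heq := hlhs.unique <| hrhs.congr_of_eventuallyEq <| .of_forall fun z => by
    simpa [shift] using two_mul_y_zero_dilation (s := s) hm z
  refine hδ.congr_fderiv (ContinuousLinearMap.ext fun X => ?_)
  have hX := congrArg (fun l : E4 →L[ℝ] ℝ => l X) heq
  have hRφ := two_mul_R_dilation (s := s) hm x
  have hK : 2 + 8 * m * R m (dilation s x) ≠ 0 := by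
    have := R_nonneg m (dilation s x)
    positivity
  simp only [smul_add, _root_.add_apply, _root_.smul_apply, smul_eq_mul, sub_add_cancel,
    Pi.neg_apply, Pi.add_apply, smul_neg, Pi.sub_apply, Pi.mul_apply, _root_.sub_apply,
    _root_.neg_apply] at hX
  simp only [smul_add, _root_.add_apply, _root_.smul_apply, smul_eq_mul]
  generalize Real.exp (-(4 * m * shift m s x)) = p at *
  generalize Real.exp (4 * m * shift m s x) = q at *
  field_simp
  linear_combination hX + 4 * m * fderiv ℝ (shift m s) x X * hRφ

end Dilation

/-- The dilation with factor `s` is asymptotic to the identity on the region `R > ρ`: the function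
`s² - 1` is `O(R⁻²)` together with its derivatives along the coframe. The last condition keeps the
image of the region away from the origin. -/
structure IsAsymptoticDilation (m ρ : ℝ) (s : E4 → ℝ) : Prop where
  one_le : 1 ≤ ρ
  contDiff : ContDiff ℝ ∞ s
  hasOrder_sq_sub_one : ∀ n, HasOrder m ρ (-2) n fun x => s x ^ 2 - 1
  half_R_le : ∀ x ∈ region m ρ, R m x / 2 ≤ R m (dilation s x)

namespace IsAsymptoticDilation

variable {m ρ : ℝ} {s : E4 → ℝ} {n : ℕ}

theorem differentiableAt (h : IsAsymptoticDilation m ρ s) (x : E4) : DifferentiableAt ℝ s x :=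
  h.contDiff.differentiable (by simp) x

theorem ne_zero (hm : 0 < m) (h : IsAsymptoticDilation m ρ s) {x : E4} (hx : x ∈ region m ρ) :
    x ≠ 0 :=
  region_subset hm h.one_le hx

theorem R_dilation_pos (hm : 0 < m) (h : IsAsymptoticDilation m ρ s) {x : E4}
    (hx : x ∈ region m ρ) : 0 < R m (dilation s x) :=
  (half_pos (R_pos hm (h.ne_zero hm hx))).trans_le (h.half_R_le x hx)

theorem hasOrder_sq (h : IsAsymptoticDilation m ρ s) : HasOrder m ρ 0 n fun x => s x ^ 2 := by
  simpa only [sub_add_cancel] using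
    IsSymbol.add ((h.hasOrder_sq_sub_one n).mono h.one_le (by norm_num)) (HasOrder.const 1)

theorem hasOrder_exp_mul_shift (h : IsAsymptoticDilation m ρ s)
    (hδ : HasOrder m ρ (-1) n (shift m s)) (c : ℝ) :
    HasOrder m ρ 0 n fun x => Real.exp (c * shift m s x) :=
  hasOrder_zero_iff.2 (.exp (hasOrder_zero_iff.1 (.const_mul c (hδ.mono h.one_le (by norm_num)))))

theorem hasOrder_exp_neg_shift (h : IsAsymptoticDilation m ρ s)
    (hδ : HasOrder m ρ (-1) n (shift m s)) :
    HasOrder m ρ 0 n fun x => Real.exp (-(4 * m * shift m s x)) := by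
  simpa only [neg_mul] using h.hasOrder_exp_mul_shift hδ (-(4 * m))

theorem hasOrder_exp_mul_add (hm : 0 < m) (h : IsAsymptoticDilation m ρ s)
    (hδ : HasOrder m ρ (-1) n (shift m s)) :
    HasOrder m ρ 1 n fun x => Real.exp (-(4 * m * shift m s x)) * (R m x + y m 0 x) :=
  (h.hasOrder_exp_neg_shift hδ).mul (l := 1) h.one_le
    (IsSymbol.add (hasOrder_R hm h.one_le) (hasOrder_y hm h.one_le 0)) (by norm_num)

theorem hasOrder_exp_mul_sub (hm : 0 < m) (h : IsAsymptoticDilation m ρ s)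
    (hδ : HasOrder m ρ (-1) n (shift m s)) :
    HasOrder m ρ 1 n fun x => Real.exp (4 * m * shift m s x) * (R m x - y m 0 x) :=
  (h.hasOrder_exp_mul_shift hδ _).mul (l := 1) h.one_le
    (IsSymbol.sub (hasOrder_R hm h.one_le) (hasOrder_y hm h.one_le 0)) (by norm_num)

theorem hasOrder_R_dilation_of_shift (hm : 0 < m) (h : IsAsymptoticDilation m ρ s)
    (hδ : HasOrder m ρ (-1) n (shift m s)) : HasOrder m ρ 1 n fun x => R m (dilation s x) := by
  have hR : HasOrder m ρ 1 n fun x => 2⁻¹ * (2 * R m (dilation s x)) := by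
    simp only [two_mul_R_dilation hm]
    exact IsSymbol.const_mul _ (h.hasOrder_sq.mul (l := 1) h.one_le
      (IsSymbol.add (h.hasOrder_exp_mul_add hm hδ) (h.hasOrder_exp_mul_sub hm hδ)) (by norm_num))
  simpa only [inv_mul_cancel_left₀ (two_ne_zero (α := ℝ))] using hR

theorem shift_isBigO (hm : 0 < m) (h : IsAsymptoticDilation m ρ s) :
    shift m s =O[𝓟 (region m ρ)] fun x => R m x ^ (-1 : ℤ) := by
  have hle : shift m s =O[𝓟 (region m ρ)] fun x => (s x ^ 2 - 1) * y m 0 x :=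
    .of_bound 1 (.of_forall fun x => by
      simpa only [norm_mul, Real.norm_eq_abs, one_mul] using abs_shift_le hm x)
  exact hle.trans (((h.hasOrder_sq_sub_one 0).mul h.one_le (hasOrder_y hm h.one_le 0)
    (by norm_num)).isBigO)

theorem hasOrder_shift (hm : 0 < m) (h : IsAsymptoticDilation m ρ s) :
    HasOrder m ρ (-1) n (shift m s) := by
  have hρ := h.one_le
  induction n with
  | zero => exact h.shift_isBigO hm
  | succ n ih =>
    obtain ⟨-, μ', hμ', hμ'_order⟩ := h.hasOrder_sq_sub_one (n + 1)
    have hp := h.hasOrder_exp_neg_shift ih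
    have hq := h.hasOrder_exp_mul_shift ih (4 * m)
    have hK : HasOrder m ρ (-1) n fun x => (2 + 8 * m * R m (dilation s x))⁻¹ := by
      refine HasOrder.inv (c := 4 * m) hρ (by positivity) (fun x hx => ?_)
        (IsSymbol.add ((HasOrder.const 2).mono hρ (by norm_num))
          (IsSymbol.const_mul _ (h.hasOrder_R_dilation_of_shift hm ih)))
      rw [zpow_one]
      linear_combination 8 * m * h.half_R_le x hx + two_pos (α := ℝ)
    have hdμ (b : Fin 4) : HasOrder m ρ 0 n _ := HasOrder.mul (k := 1) hρ
      (IsSymbol.sub (h.hasOrder_exp_mul_add hm ih) (h.hasOrder_exp_mul_sub hm ih)) (hμ'_order b)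
      (by norm_num)
    have hdR (b : Fin 4) : HasOrder m ρ 0 n _ :=
      (h.hasOrder_sq.mul (l := 0) (j := 0) hρ (IsSymbol.sub hp hq) le_rfl).mul hρ
        (hasOrder_gradR hm hρ b) le_rfl
    have hdy (b : Fin 4) : HasOrder m ρ 0 n _ := HasOrder.mul (k := 0) hρ
      (IsSymbol.sub (h.hasOrder_sq.mul (l := 0) hρ (IsSymbol.add hp hq) le_rfl)
        (HasOrder.const 2)) (HasOrder.const (if b = 0 then 1 else 0)) le_rfl
    refine ⟨h.shift_isBigO hm, _, fun x hx => ?_, fun b => hK.mul (l := 0) hρ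
      (((hdμ b).add (hdR b)).add (hdy b)) (by norm_num)⟩
    refine (hasFDerivAt_shift hm (h.differentiableAt x) (hasFDerivAt_R_gradR hm (h.ne_zero hm hx))
      (hμ' x hx)).congr_fderiv ?_
    simp only [Fin.sum_univ_four, smul_add, mul_ite, mul_one, mul_zero, ↓reduceIte, one_ne_zero,
      add_zero, Fin.reduceEq]
    module

theorem hasOrder_y_dilation_sub (hm : 0 < m) (h : IsAsymptoticDilation m ρ s) (i : Fin 3) :
    HasOrder m ρ (-1) n fun x => y m i (dilation s x) - y m i x := by
  have hmul (i : Fin 3) : HasOrder m ρ (-1) n fun x => (s x ^ 2 - 1) * y m i x :=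
    (h.hasOrder_sq_sub_one n).mul h.one_le (hasOrder_y hm h.one_le i) (by norm_num)
  fin_cases i
  · exact h.hasOrder_shift hm
  · refine (congrArg (HasOrder m ρ (-1) n) (funext fun x => ?_)).mp (hmul 1)
    rw [sub_one_mul, ← y_one_dilation]
    rfl
  · refine (congrArg (HasOrder m ρ (-1) n) (funext fun x => ?_)).mp (hmul 2)
    rw [sub_one_mul, ← y_two_dilation]
    rfl

theorem hasOrder_R_dilation (hm : 0 < m) (h : IsAsymptoticDilation m ρ s) :
    HasOrder m ρ 1 n fun x => R m (dilation s x) :=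
  h.hasOrder_R_dilation_of_shift hm (h.hasOrder_shift hm)

theorem hasOrder_R_dilation_inv (hm : 0 < m) (h : IsAsymptoticDilation m ρ s) :
    HasOrder m ρ (-1) n fun x => (R m (dilation s x))⁻¹ :=
  HasOrder.inv h.one_le one_half_pos (fun x hx => by
    simpa only [zpow_one, one_div_mul_eq_div] using h.half_R_le x hx) (h.hasOrder_R_dilation hm)

theorem hasOrder_V_dilation_sub (hm : 0 < m) (h : IsAsymptoticDilation m ρ s) :
    HasOrder m ρ (-1) n fun x => V m (dilation s x) - V m x := by
  refine IsSymbol.congr (isOpen_region hm ρ) (IsSymbol.const_mul 2⁻¹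
    (IsSymbol.sub (h.hasOrder_R_dilation_inv hm) (hasOrder_R_inv hm h.one_le))) fun x hx => ?_
  simp only [V_eq hm (ne_zero_of_R_pos hm (h.R_dilation_pos hm hx)), V_eq hm (h.ne_zero hm hx),
    mul_inv]
  ring

theorem hasOrder_V_dilation_inv (hm : 0 < m) (h : IsAsymptoticDilation m ρ s) :
    HasOrder m ρ 0 n fun x => (V m (dilation s x))⁻¹ := by
  have hV : HasOrder m ρ 0 n fun x => V m (dilation s x) := by
    simpa only [sub_add_cancel] using IsSymbol.add
      ((h.hasOrder_V_dilation_sub hm).mono h.one_le (by norm_num)) (hasOrder_V hm h.one_le)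
  exact HasOrder.inv (c := 2 * m) (k := 0) h.one_le (by positivity) (fun x hx => by
    simpa only [zpow_zero, mul_one] using
      two_mul_le_V hm (ne_zero_of_R_pos hm (h.R_dilation_pos hm hx))) hV

theorem hasOrder_diagCoeff_dilation_sub (hm : 0 < m) (h : IsAsymptoticDilation m ρ s)
    (c : Fin 4) : HasOrder m ρ (-1) n fun x => diagCoeff m c (dilation s x) - diagCoeff m c x := by
  have hV : HasOrder m ρ (-1) n fun x => V m (dilation s x) - V m x :=
    h.hasOrder_V_dilation_sub hm
  have hV_inv : HasOrder m ρ (-1) n fun x => (V m (dilation s x))⁻¹ - (V m x)⁻¹ := by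
    refine IsSymbol.congr (isOpen_region hm ρ) (((h.hasOrder_V_dilation_inv hm).mul h.one_le
      (hV.mul h.one_le (hasOrder_V_inv hm h.one_le) le_rfl) le_rfl).neg) fun x hx => ?_
    have hV₀ := (V_pos hm (h.ne_zero hm hx)).ne'
    have hVφ := (V_pos hm (ne_zero_of_R_pos hm (h.R_dilation_pos hm hx))).ne'
    field_simp
    ring
  fin_cases c
  exacts [hV, hV, hV, hV_inv]

theorem hasOrder_diagCoeff_dilation (hm : 0 < m) (h : IsAsymptoticDilation m ρ s) (c : Fin 4) :
    HasOrder m ρ 0 n fun x => diagCoeff m c (dilation s x) := by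
  simpa only [sub_add_cancel] using IsSymbol.add
    ((h.hasOrder_diagCoeff_dilation_sub hm c).mono h.one_le (by norm_num))
    (hasOrder_diagCoeff hm h.one_le c)

end IsAsymptoticDilation

/-! ### Pull-back by a dilation -/

section Pullback

variable {g : BilinField} {θ : Fin 4 → E4 → E4 →L[ℝ] ℝ} {d : Fin 4 → E4 → ℝ} {Ω : Set E4}

theorem Diagonalizes.pullback_apply (h : Diagonalizes θ d g Ω) {F : E4 → E4} {x : E4}
    (hx : F x ∈ Ω) (i j : Fin 4) :
    pullback F g x i j = ∑ c, d c (F x) *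
      (θ c (F x) (fderiv ℝ F x (basisVec i)) * θ c (F x) (fderiv ℝ F x (basisVec j))) := by
  simp only [pullback, of_apply, h.eq_sum _ hx, coframeMatrix,
    apply_eq_sum_basisVec _ (fderiv ℝ F x (basisVec _)), Finset.sum_mul_sum]
  simp only [Finset.mul_sum, Finset.sum_mul]
  conv_lhs => enter [2, k]; rw [Finset.sum_comm]
  rw [Finset.sum_comm]
  exact Finset.sum_congr rfl fun c _ => Finset.sum_congr rfl fun k _ =>
    Finset.sum_congr rfl fun l _ => by ring

theorem hasComponents_toTensor {h : BilinField} {e : Fin 4 → E4 → ℝ}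
    {N : Fin 4 → Fin 4 → E4 → ℝ}
    (hh : ∀ x ∈ Ω, ∀ i j, h x i j = ∑ c, e c x *
      ((∑ a, N c a x * coframeMatrix θ x a i) * ∑ b, N c b x * coframeMatrix θ x b j)) :
    HasComponents θ Ω (BilinField.toTensor h) fun A x =>
      ∑ c, e c x * (N c (A 0) x * N c (A 1) x) := by
  intro x hx I
  rw [← (finTwoArrowEquiv (Fin 4)).symm.sum_comp, Fintype.sum_prod_type]
  simp only [BilinField.toTensor, hh x hx, coframeTensor, Fin.prod_univ_two,
    finTwoArrowEquiv_symm_apply, cons_val_zero, cons_val_one, Finset.sum_mul_sum]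
  simp only [Finset.mul_sum, Finset.sum_mul]
  conv_rhs => enter [2, b]; rw [Finset.sum_comm]
  rw [Finset.sum_comm]
  exact Finset.sum_congr rfl fun a _ => Finset.sum_congr rfl fun c _ =>
    Finset.sum_congr rfl fun b _ => by ring

theorem HasComponents.sub {r : ℕ} {T S : TensorField r} {t u : (Fin r → Fin 4) → E4 → ℝ}
    (hT : HasComponents θ Ω T t) (hS : HasComponents θ Ω S u) :
    HasComponents θ Ω (T - S) fun A x => t A x - u A x := by
  intro x hx I
  simp only [Pi.sub_apply, hT x hx, hS x hx, sub_mul, Finset.sum_sub_distrib]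

theorem Diagonalizes.hasComponents_pullback_sub (h : Diagonalizes θ d g Ω) {F : E4 → E4}
    {Ω' : Set E4} (hΩ : Ω' ⊆ Ω) (hF : Set.MapsTo F Ω' Ω) {M : Fin 4 → Fin 4 → E4 → ℝ}
    (hM : ∀ x ∈ Ω', ∀ c X,
      θ c (F x) (fderiv ℝ F x X) = θ c x X + ∑ b, M c b x * θ b x X) :
    HasComponents θ Ω' (BilinField.toTensor (pullback F g - g)) fun A x => ∑ c,
      ((d c (F x) - d c x) * ((1 : Matrix (Fin 4) (Fin 4) ℝ) c (A 0) *
          (1 : Matrix (Fin 4) (Fin 4) ℝ) c (A 1))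
        + d c (F x) * ((1 : Matrix (Fin 4) (Fin 4) ℝ) c (A 0) * M c (A 1) x
          + (1 : Matrix (Fin 4) (Fin 4) ℝ) c (A 1) * M c (A 0) x + M c (A 0) x * M c (A 1) x)) := by
  have hpull : HasComponents θ Ω' (BilinField.toTensor (pullback F g)) _ :=
    hasComponents_toTensor (e := fun c x => d c (F x))
      (N := fun c b x => (1 : Matrix (Fin 4) (Fin 4) ℝ) c b + M c b x) fun x hx i j => by
        simp [h.pullback_apply (hF hx), hM x hx, add_mul, Finset.sum_add_distrib, one_apply,
          coframeMatrix]
  have hg : HasComponents θ Ω' (BilinField.toTensor g) _ :=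
    hasComponents_toTensor (e := d) (N := fun c b _ => (1 : Matrix (Fin 4) (Fin 4) ℝ) c b)
      fun x hx i j => by simp [h.eq_sum x (hΩ hx), one_apply]
  refine (congrArg (HasComponents θ Ω' _) ?_).mp (hpull.sub hg)
  funext A x
  rw [← Finset.sum_sub_distrib]
  exact Finset.sum_congr rfl fun c _ => by ring

end Pullback

section DilationPullback

variable {m ρ : ℝ} {s : E4 → ℝ} {n : ℕ} {x : E4}

theorem coframe_castSucc_dilation (hm : 0 < m) (hs : DifferentiableAt ℝ s x) {i : Fin 3}
    {G : E4 →L[ℝ] ℝ} (hG : HasFDerivAt (fun z => y m i (dilation s z) - y m i z) G x) (X : E4) :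
    coframe m i.castSucc (dilation s x) (fderiv ℝ (dilation s) x X)
      = coframe m i.castSucc x X + G X := by
  have hφ : DifferentiableAt ℝ (dilation s) x := hs.smul differentiableAt_id
  have hsub := ((hasFDerivAt_y hm i (dilation s x)).comp x hφ.hasFDerivAt).sub
    (hasFDerivAt_y hm i x)
  rw [hG.unique hsub]
  simp

/-- The coefficient `τ` for which `φ^*η = η + τ (y₂ dy₃ - y₃ dy₂)`, where `φ` is the dilation with
factor `s`. -/
def twist (m : ℝ) (s : E4 → ℝ) (x : E4) : ℝ :=
  4⁻¹ * (s x ^ 2 * (Real.exp (-(4 * m * shift m s x)) - Real.exp (4 * m * shift m s x))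
    * ((R m x)⁻¹ * (R m (dilation s x))⁻¹))

theorem coframe_three_dilation (hm : 0 < m) (hs : DifferentiableAt ℝ s x) (hR : 0 < R m x)
    (hRφ : 0 < R m (dilation s x)) (X : E4) :
    coframe m 3 (dilation s x) (fderiv ℝ (dilation s) x X) = coframe m 3 x X
      + twist m s x * (y m 1 x * coframe m 2 x X - y m 2 x * coframe m 1 x X) := by
  have hR_eq := two_mul_R hm x
  have hRφ_eq := two_mul_R_dilation (s := s) hm x
  have hPQ := P_mul_Q m x
  rw [← P_mul_norm_sq hm, ← Q_mul_norm_sq hm] at hRφ_eq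
  simp only [norm_z₁_sq, norm_z₂_sq] at hR_eq hRφ_eq
  simp only [coframe_three_apply, coframe_one_apply, coframe_two_apply, angularDiff_apply,
    rot₁_apply, rot₂_apply, y_one, y_two, P_dilation, Q_dilation, twist, fderiv_dilation_apply hs,
    dilation_apply]
  generalize Real.exp (-(4 * m * shift m s x)) = p at *
  generalize Real.exp (4 * m * shift m s x) = q at *
  generalize fderiv ℝ s x X = l at *
  generalize s x = c at *
  generalize R m (dilation s x) = r at *
  field_simp
  linear_combination
    2 * c ^ 2 * (P m x * p * (x 0 * X 1 - x 1 * X 0) - Q m x * q * (x 2 * X 3 - x 3 * X 2)) * hR_eq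
    - 2 * (P m x * (x 0 * X 1 - x 1 * X 0) - Q m x * (x 2 * X 3 - x 3 * X 2)) * hRφ_eq
    + 2 * c ^ 2 * (p - q) * ((x 2 ^ 2 + x 3 ^ 2) * (x 0 * X 1 - x 1 * X 0)
      + (x 0 ^ 2 + x 1 ^ 2) * (x 2 * X 3 - x 3 * X 2)) * hPQ

namespace IsAsymptoticDilation

theorem hasOrder_twist (hm : 0 < m) (h : IsAsymptoticDilation m ρ s) :
    HasOrder m ρ (-2) n (twist m s) := by
  have hδ : HasOrder m ρ (-1) n (shift m s) := h.hasOrder_shift hm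
  exact IsSymbol.const_mul _ ((h.hasOrder_sq.mul (l := 0) (j := 0) h.one_le
    (IsSymbol.sub (h.hasOrder_exp_neg_shift hδ) (h.hasOrder_exp_mul_shift hδ _)) le_rfl).mul
      h.one_le ((hasOrder_R_inv hm h.one_le).mul h.one_le (h.hasOrder_R_dilation_inv hm) le_rfl)
      (by norm_num))

theorem exists_coframe_dilation (hm : 0 < m) (h : IsAsymptoticDilation m ρ s) (n : ℕ) :
    ∃ M : Fin 4 → Fin 4 → E4 → ℝ, (∀ c b, HasOrder m ρ (-1) n (M c b)) ∧
      ∀ x ∈ region m ρ, ∀ c X, coframe m c (dilation s x) (fderiv ℝ (dilation s) x X)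
        = coframe m c x X + ∑ b, M c b x * coframe m b x X := by
  choose G hG hG_order using fun i => (h.hasOrder_y_dilation_sub (n := n + 1) hm i).2
  have hτy (i : Fin 3) : HasOrder m ρ (-1) n fun x => twist m s x * y m i x :=
    (h.hasOrder_twist hm).mul h.one_le (hasOrder_y hm h.one_le i) (by norm_num)
  refine ⟨Fin.lastCases ![fun _ => 0, fun x => -(twist m s x * y m 2 x),
    fun x => twist m s x * y m 1 x, fun _ => 0] G, fun c b => ?_, fun x hx c X => ?_⟩
  · induction c using Fin.lastCases with
    | last =>
      simp only [Fin.lastCases_last]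
      fin_cases b
      exacts [IsSymbol.zero, (hτy 2).neg, hτy 1, IsSymbol.zero]
    | cast i => simpa only [Fin.lastCases_castSucc] using hG_order i b
  · induction c using Fin.lastCases with
    | last =>
      simp only [Fin.lastCases_last]
      refine (coframe_three_dilation hm (h.differentiableAt x) (R_pos hm (h.ne_zero hm hx))
        (h.R_dilation_pos hm hx) X).trans ?_
      simp only [Fin.reduceLast, Fin.sum_univ_four, cons_val]
      ring
    | cast i =>
      simpa using coframe_castSucc_dilation hm (h.differentiableAt x) (hG i x hx) X

theorem exists_hasComponents_pullback_sub (hm : 0 < m) (h : IsAsymptoticDilation m ρ s) (n : ℕ) :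
    ∃ t, HasComponents (coframe m) (region m ρ)
        (BilinField.toTensor (pullback (dilation s) (taubNUT m) - taubNUT m)) t ∧
      ∀ A, HasOrder m ρ (-1) n (t A) := by
  have hρ := h.one_le
  obtain ⟨M, hM_order, hM⟩ := h.exists_coframe_dilation hm n
  refine ⟨_, (diagonalizes_taubNUT hm).hasComponents_pullback_sub (region_subset hm hρ)
    (fun x hx => ne_zero_of_R_pos hm (h.R_dilation_pos hm hx)) hM, fun A => ?_⟩
  have hMM (c a b : Fin 4) : HasOrder m ρ (-1) n fun x => M c a x * M c b x :=
    (hM_order c a).mul hρ (hM_order c b) (by norm_num)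
  exact .sum _ fun c _ => .add
    ((h.hasOrder_diagCoeff_dilation_sub hm c).mul hρ (HasOrder.const _) (by norm_num))
    ((h.hasOrder_diagCoeff_dilation hm c).mul (l := -1) hρ
      (.add (.add (.const_mul _ (hM_order c _)) (.const_mul _ (hM_order c _))) (hMM c _ _))
      (by norm_num))

theorem tensorNorm_pullback_sub_isBigO (hm : 0 < m) (h : IsAsymptoticDilation m ρ s) (ℓ : ℕ) :
    tensorNorm (taubNUT m) (iterCovDeriv (taubNUT m)
        (BilinField.toTensor (pullback (dilation s) (taubNUT m) - taubNUT m)) ℓ)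
      =O[𝓟 (region m ρ)] fun x => R m x ^ (-1 : ℤ) := by
  obtain ⟨t, ht, ht_order⟩ := h.exists_hasComponents_pullback_sub hm ℓ
  exact ht.tensorNorm_iterCovDeriv_isBigO hm h.one_le ht_order

theorem R_dilation_sub_isBigO (hm : 0 < m) (h : IsAsymptoticDilation m ρ s) :
    (fun x => R m (dilation s x) - R m x) =O[𝓟 (region m ρ)] fun x => R m x ^ (-1 : ℤ) := by
  have hle : (fun x => R m (dilation s x) - R m x)
      =O[𝓟 (region m ρ)] fun x => (s x ^ 2 - 1) * R m x :=
    .of_bound 1 (.of_forall fun x => by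
      simpa only [norm_mul, Real.norm_eq_abs, abs_of_nonneg (R_nonneg m x), one_mul] using
        abs_R_dilation_sub_le hm x)
  exact hle.trans ((h.hasOrder_sq_sub_one 0).mul h.one_le (hasOrder_R hm h.one_le)
    (by norm_num)).isBigO

end IsAsymptoticDilation

end DilationPullback

/-! ### The map `ℶ` -/

section Beth

variable {m ρ κ : ℝ} {n : ℕ}

theorem norm_sq_eq_add (hm : 0 < m) (x : E4) :
    ‖x‖ ^ 2 = (P m x + Q m x) * R m x + (Q m x - P m x) * y m 0 x := by
  rw [norm_sq_eq]
  linear_combination Q m x * P_mul_norm_sq hm x + P m x * Q_mul_norm_sq hm x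
    - (‖z₁ x‖ ^ 2 + ‖z₂ x‖ ^ 2) * P_mul_Q m x

theorem add_mul_R_le_norm_sq (hm : 0 < m) (x : E4) : (P m x + Q m x) * R m x ≤ ‖x‖ ^ 2 := by
  have hsign : 0 ≤ (Q m x - P m x) * y m 0 x := by
    rcases le_total 0 (y m 0 x) with hy | hy
    · exact mul_nonneg (sub_nonneg.2 (Real.exp_le_exp.2 (by nlinarith))) hy
    · exact mul_nonneg_of_nonpos_of_nonpos (sub_nonpos.2 (Real.exp_le_exp.2 (by nlinarith))) hy
  linarith [norm_sq_eq_add hm x]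

theorem R_le_norm_sq (hm : 0 < m) (x : E4) : R m x ≤ ‖x‖ ^ 2 := by
  have hPQ : 1 ≤ P m x + Q m x := by
    nlinarith [P_pos m x, Q_pos m x, P_mul_Q m x]
  exact (le_mul_of_one_le_left (R_nonneg m x) hPQ).trans (add_mul_R_le_norm_sq hm x)

theorem isSymbol_exp_mul_y_zero (hm : 0 < m) (c : ℝ) :
    IsSymbol (coframe m) (region m ρ) (fun x => Real.exp (c * y m 0 x)) n
      fun x => Real.exp (c * y m 0 x) := by
  refine (IsSymbol.of_hasFDerivAt_mul (c := fun a _ => if a = 0 then c else 0) (isBigO_refl _ _)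
    (fun x _ => ?_) fun a => .const _).of_succ
  simpa [mul_smul] using ((hasFDerivAt_y hm 0 x).const_mul c).exp

theorem isSymbol_norm_sq (hm : 0 < m) (hρ : 1 ≤ ρ) :
    IsSymbol (coframe m) (region m ρ) (fun x => ‖x‖ ^ 2) n fun x => ‖x‖ ^ 2 := by
  have hP_pos := P_pos m
  have hQ_pos := Q_pos m
  have hP : IsSymbol (coframe m) (region m ρ) (P m + Q m) n (P m) := by
    refine IsSymbol.weight_mono (w := P m) (.of_norm_le fun x => ?_) ?_
    · rw [Real.norm_of_nonneg (hP_pos x).le, Pi.add_apply]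
      linarith [hQ_pos x]
    · simpa only [neg_mul] using! isSymbol_exp_mul_y_zero hm (-(4 * m))
  have hQ : IsSymbol (coframe m) (region m ρ) (P m + Q m) n (Q m) := by
    refine IsSymbol.weight_mono (w := Q m) (.of_norm_le fun x => ?_)
      (isSymbol_exp_mul_y_zero hm (4 * m))
    rw [Real.norm_of_nonneg (hQ_pos x).le, Pi.add_apply]
    linarith [hP_pos x]
  have hsum := ((hP.add hQ).mul (hasOrder_R hm hρ)).add ((hQ.sub hP).mul (hasOrder_y hm hρ 0))
  simp only [← norm_sq_eq_add hm] at hsum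
  refine hsum.weight_mono (.of_norm_le fun x => ?_)
  have hPQR : 0 ≤ (P m x + Q m x) * R m x :=
    mul_nonneg (add_pos (hP_pos x) (hQ_pos x)).le (R_nonneg m x)
  rw [Pi.mul_apply, Pi.add_apply, zpow_one, Real.norm_of_nonneg hPQR]
  exact add_mul_R_le_norm_sq hm x

theorem isSymbol_add_norm_pow_four (hm : 0 < m) (hκ : 0 < κ) (hρ : 1 ≤ ρ) :
    IsSymbol (coframe m) (region m ρ) (fun x => κ + ‖x‖ ^ 4) n fun x => κ + ‖x‖ ^ 4 := by
  have hpow : IsSymbol (coframe m) (region m ρ) (fun x => ‖x‖ ^ 4) n fun x => ‖x‖ ^ 4 := by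
    have hsq := (isSymbol_norm_sq (n := n) hm hρ).mul (isSymbol_norm_sq hm hρ)
    simpa only [Pi.mul_def, ← pow_add] using hsq
  refine ((IsSymbol.const κ).weight_mono (.of_bound κ⁻¹ (.of_forall fun x => ?_))).add
    (hpow.weight_mono (.of_norm_le fun x => ?_))
  · rw [Pi.one_apply, norm_one, Real.norm_of_nonneg (by positivity), mul_add,
      inv_mul_cancel₀ hκ.ne']
    exact le_add_of_nonneg_right (by positivity)
  · rw [Real.norm_of_nonneg (by positivity)]
    exact le_add_of_nonneg_left hκ.le

theorem hasOrder_inv_add_norm_pow_four (hm : 0 < m) (hκ : 0 < κ) (hρ : 1 ≤ ρ) :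
    HasOrder m ρ (-2) n fun x => (κ + ‖x‖ ^ 4)⁻¹ := by
  refine (IsSymbol.inv (fun x _ => by positivity) (isBigO_refl _ _)
    (isSymbol_add_norm_pow_four hm hκ hρ)).weight_mono (.of_bound 1 ?_)
  refine eventually_principal.2 fun x hx => ?_
  have hR : 0 < R m x := zero_lt_one.trans_le hρ |>.trans hx
  rw [one_mul, Pi.inv_apply, _root_.zpow_neg, zpow_ofNat, norm_inv, norm_inv,
    Real.norm_of_nonneg (by positivity), Real.norm_of_nonneg (by positivity)]
  refine inv_anti₀ (by positivity) ?_
  calc R m x ^ 2 ≤ (‖x‖ ^ 2) ^ 2 := by gcongr; exact R_le_norm_sq hm x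
    _ = ‖x‖ ^ 4 := by rw [← pow_mul]
    _ ≤ κ + ‖x‖ ^ 4 := le_add_of_nonneg_left hκ.le

theorem hasOrder_beth_factor_sq_sub_one (hm : 0 < m) (a : ℝ) (hκ : 0 < κ) (hρ : 1 ≤ ρ) :
    HasOrder m ρ (-2) n fun x => (1 + a / (κ + ‖x‖ ^ 4)) ^ 2 - 1 := by
  have hquot : HasOrder m ρ (-2) n fun x => a / (κ + ‖x‖ ^ 4) :=
    IsSymbol.const_mul a (hasOrder_inv_add_norm_pow_four hm hκ hρ)
  have hexpand : (fun x : E4 => (1 + a / (κ + ‖x‖ ^ 4)) ^ 2 - 1) =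
      fun x => 2 * (a / (κ + ‖x‖ ^ 4)) + a / (κ + ‖x‖ ^ 4) * (a / (κ + ‖x‖ ^ 4)) := by
    ext x
    ring
  rw [hexpand]
  exact IsSymbol.add (.const_mul 2 hquot) (hquot.mul hρ hquot (by norm_num))

theorem contDiff_beth_factor (a : ℝ) {κ : ℝ} (hκ : 0 < κ) :
    ContDiff ℝ ∞ fun x : E4 => 1 + a / (κ + ‖x‖ ^ 4) := by
  have hnorm : ContDiff ℝ ∞ fun x : E4 => ‖x‖ ^ 4 := by
    simpa only [← pow_mul] using (contDiff_norm_sq ℝ (E := E4)).pow 2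
  exact contDiff_const.add <| contDiff_const.div (contDiff_const.add hnorm) fun x => by positivity

theorem exists_isAsymptoticDilation_beth (hm : 0 < m) (a : ℝ) (hκ : 0 < κ) :
    ∃ ρ, IsAsymptoticDilation m ρ fun x => 1 + a / (κ + ‖x‖ ^ 4) := by
  obtain ⟨C, hC⟩ := isBigO_principal.1
    (hasOrder_beth_factor_sq_sub_one (n := 0) hm a hκ le_rfl).isBigO
  have hone : 1 ≤ 1 + 2 * |C| := le_add_of_nonneg_right (by positivity)
  refine ⟨1 + 2 * |C|, hone, contDiff_beth_factor a hκ,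
    fun n => hasOrder_beth_factor_sq_sub_one hm a hκ hone, fun x (hx : _ < R m x) => ?_⟩
  have hR : 1 < R m x := hone.trans_lt hx
  have hsub : |R m (dilation (fun x => 1 + a / (κ + ‖x‖ ^ 4)) x) - R m x| ≤ R m x / 2 := calc
    _ ≤ |(1 + a / (κ + ‖x‖ ^ 4)) ^ 2 - 1| * R m x := abs_R_dilation_sub_le hm x
    _ ≤ C * ‖R m x ^ (-2 : ℤ)‖ * R m x := by gcongr; exact hC x hR
    _ = C * (R m x)⁻¹ := by
      rw [_root_.zpow_neg, zpow_ofNat, Real.norm_of_nonneg (by positivity)]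
      field_simp
    _ ≤ |C| * 1 := by
      gcongr
      exacts [le_abs_self C, inv_le_one_of_one_le₀ hR.le]
    _ ≤ R m x / 2 := by linarith
  linarith [(abs_le.1 hsub).1]

end Beth

end TaubNUT

end

open TaubNUT in
open scoped ContDiff in
theorem lemma1p11_general (m a κ : ℝ) (hm : 0 < m) (hκ : 0 < κ) :
    (∀ ℓ : ℕ, ∃ C : ℝ, ∀ x : E4, x ≠ 0 →
      tensorNorm (taubNUT m) (iterCovDeriv (taubNUT m)
          (BilinField.toTensor (pullback (beth a κ) (taubNUT m) - taubNUT m)) ℓ) x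
        ≤ C * (R m x)⁻¹) ∧
    ∃ C : ℝ, ∀ x : E4, x ≠ 0 → |R m (beth a κ x) - R m x| ≤ C * (R m x)⁻¹ := by
  obtain ⟨ρ, hbeth⟩ := exists_isAsymptoticDilation_beth hm a hκ
  have hg := contDiff_taubNUT hm
  have hdet := det_taubNUT_ne_zero hm
  have hβ : ContDiff ℝ ∞ (beth a κ) := contDiff_dilation (contDiff_beth_factor a hκ)
  refine ⟨fun ℓ => ?_, ?_⟩
  · have hdiff := contDiff_iterCovDeriv hg hdet
      (fun I : Fin 2 → Fin 4 => (contDiff_pullback hβ hg (I 0) (I 1)).sub (hg (I 0) (I 1))) ℓ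
    obtain ⟨C, hC⟩ := exists_bound_of_continuous hm (continuous_tensorNorm
        (fun i j => (hg i j).continuous) hdet fun I => (hdiff I).continuous)
      (hbeth.tensorNorm_pullback_sub_isBigO hm ℓ)
    exact ⟨C, fun x hx => (le_abs_self _).trans (hC x hx)⟩
  · have hR := (contDiff_R hm).continuous
    exact exists_bound_of_continuous hm ((hR.comp hβ.continuous).sub hR)
      (hbeth.R_dilation_sub_isBigO hm)

theorem lemma1p11 (m a κ : ℝ) (hm : 0 < m) (hκ : 0 < κ) :
    (∀ ℓ : ℕ, ℓ ≤ 2 → ∃ C : ℝ, ∀ x : TaubNUT.E4, x ≠ 0 →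
      TaubNUT.tensorNorm (TaubNUT.taubNUT m)
        (TaubNUT.iterCovDeriv (TaubNUT.taubNUT m)
          (TaubNUT.BilinField.toTensor
            (TaubNUT.pullback (TaubNUT.beth a κ) (TaubNUT.taubNUT m) - TaubNUT.taubNUT m)) ℓ) x
        ≤ C * (TaubNUT.R m x)⁻¹) ∧
    (∃ C : ℝ, ∀ x : TaubNUT.E4, x ≠ 0 →
      |TaubNUT.R m (TaubNUT.beth a κ x) - TaubNUT.R m x| ≤ C * (TaubNUT.R m x)⁻¹) :=
  ⟨fun ℓ _ => (lemma1p11_general m a κ hm hκ).1 ℓ, (lemma1p11_general m a κ hm hκ).2⟩
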